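/- **Setting.** There are a coordinator and $k\ge 1$ players. Items arrive one by one; independently of the others, each item arrives at player $i$ with probability $\mu_i$, where $\mu_i\ge 0$ and $\sum_{i=1}^k\mu_i=1$ (the $\mu_i$ are known). The coordinator has to raise an alarm exactly at the arrival of the $N$-th item. The communication cost is the number of messages sent and received by the coordinator. **The algorithm DynSlk-KwnDst** with parameter $\delta\in(0,1)$ runs in rounds. Each round starts with the remaining threshold $N$ and with all counters $n_i=0$; $n_i$ counts the items that arrive at player $i$ in the round. 1. If $N\le 4k$, run the straightforward algorithm (the coordinator sends one message to each player, and every item is then reported to it) until the alarm at the $N$-th item. 2. Otherwise, if $N\le \beta k\ln\frac k\delta$ with $\beta=2(\sqrt2+\frac23)^2$, switch for good to the algorithm CMY. It too runs in rounds: if $N<4k$ it runs the straightforward algorithm; otherwise the coordinator sends $s=\lfloor\frac N{2k}\rfloor$ to each player, and a player sends a notification for every increase of its counter by $s$. 3. Otherwise let $t=N-(\sqrt2+\frac23)\sqrt{kN\ln\frac k\delta}$. The coordinator sends to player $i$ the pair $(b_i,s)$ with $b_i=\mu_i t$ and $s=\lfloor\frac{N-t}{2k}\rfloor$. Player $i$,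 once $n_i\ge b_i$, sends a notification for every further increase of $n_i$ by $s$, that is, whenever $n_i=\lceil b_i\rceil+js$ with $j\ge1$. In the rounds of the last two kinds, at the $k$-th notification ($k$-Notifications-to-End) the coordinator collects all counters (with $k$ requests and $k$ answers) and replaces $N$ by $N-\sum_i n_i$. If the result is $0$ it raises the alarm; otherwise the next round starts (of CMY, after a switch to CMY). **Theorem.** Write $\operatorname{LL}(y)=\log^+\log^+ y$, where $\log^+y=\max(0,\log y)$ for $y>0$ and $\log^+0=0$. There is an absolute constant $C>0$ such that for all $k$, $N$, $(\mu_i)$ and $\delta\in(0,1)$, with probability at least $1-\delta'$, where $\delta'=C\,\delta\,\operatorname{LL}(N)$, DynSlk-KwnDst with threshold $N$ raises the alarm exactly at the arrival of the $N$-th item, and until then - it runs at most $C\left(1+\operatorname{LL}\!\left(\frac{N}{k\log\frac k\delta}\right)+\operatorname{LL}\!\left(\frac k\delta\right)\right)$ rounds; - its total communication cost is at most $C\,k\left(1+\operatorname{LL}\!\left(\frac{N}{k\log\frac k\delta}\right)+\operatorname{LL}\!\left(\frac k\delta\right)\right)$ messages. That is, the bounds are $O(\log\log\frac{N}{k\log(k/\delta)}+\log\log\frac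 k\delta)$ rounds and $O(k\log\log\frac{N}{k\log(k/\delta)}+k\log\log\frac k\delta)$ communication, with failure probability $\delta'=\delta\cdot O(\log\log N)$. -/

import Mathlib

namespace DistributedTracking

/-- The characteristics of an `ℓ`-Notifications-to-End algorithm for `k` players: the slack that
the coordinator sends to player `i` in a round with threshold `N`, the condition under which a
player with a given slack sends a notification when its counter has just become `n`, and the number
`ℓ` of notifications that ends a round. -/
structure Characteristics (k : ℕ) where
  Slack : Type
  slack : ℕ → Fin k → Slack
  notifies : Slack → ℕ → Prop
  ell : ℕ

/-- The (simplified) CMY algorithm: slack `⌊N / (2k)⌋`, a notification for every increase of the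
counter by the slack, and `ℓ = k`. -/
def cmy (k : ℕ) : Characteristics k where
  Slack := ℕ
  slack := fun N _ => N / (2 * k)
  notifies := fun s n => s ∣ n
  ell := k

/-- The number `t = N - (√2 + 2/3) √(k N ln (k/δ))` of items that a round aims to track. -/
noncomputable def target (k : ℕ) (δ : ℝ) (N : ℕ) : ℝ :=
  N - (√2 + 2 / 3) * √(k * N * Real.log (k / δ))

/-- DynSlk-KwnDst: the slack is the pair of the base `b = μ i * t` and the tolerance
`s = ⌊(N - t) / (2k)⌋`; once the counter `n` has reached `b` (that is, at `n = ⌈b⌉`), the player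
notifies for every further increase of the counter by `s`; and `ℓ = k`. -/
noncomputable def dynSlk (k : ℕ) (δ : ℝ) (μ : Fin k → ℝ) : Characteristics k where
  Slack := ℝ × ℕ
  slack := fun N i => (μ i * target k δ N, ⌊(N - target k δ N) / (2 * k)⌋₊)
  notifies := fun bs n => ∃ j : ℕ, 1 ≤ j ∧ n = ⌈bs.1⌉₊ + j * bs.2
  ell := k

/-- What the coordinator and the players are currently executing. -/
inductive Mode
  /-- every item is reported to the coordinator -/
  | straightforward
  /-- a slack round of CMY, to which the algorithm has switched for good -/
  | cmy
  /-- a slack round of the algorithm that is plugged into the framework -/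
  | custom
  /-- the alarm has been raised and the algorithm has terminated -/
  | alarm

/-- The global state of an execution with `k` players. -/
structure State (k : ℕ) where
  mode : Mode
  /-- the threshold of the current round -/
  thr : ℕ
  /-- the counters of the players in the current round -/
  cnt : Fin k → ℕ
  /-- the number of notifications that the coordinator received in the current round -/
  notes : ℕ
  /-- the number of rounds started so far -/
  rounds : ℕ
  /-- the number of messages sent and received by the coordinator so far -/
  msgs : ℕ

/-- The end of one round and the start of the next with threshold `N`, after `r` rounds and `m`
messages. If `N = 0` the alarm is raised. Otherwise the coordinator sends one message to each
player (the slack, or the order to report every item). -/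
def startRound {k : ℕ} (mode : Mode) (N r m : ℕ) : State k :=
  if N = 0 then ⟨.alarm, 0, fun _ => 0, 0, r, m⟩
  else ⟨mode, N, fun _ => 0, 0, r + 1, m + k⟩

/-- A round of CMY with threshold `N`. -/
def startCMY {k : ℕ} (N r m : ℕ) : State k :=
  startRound (if N < 4 * k then .straightforward else .cmy) N r m

open Classical in
/-- A round of the framework with threshold `N`: the straightforward algorithm if `N ≤ 4k`, else
CMY if `N ≤ β k ln (k/δ)`, else a slack round of the plugged-in algorithm. -/
noncomputable def startFramework {k : ℕ} (β δ : ℝ) (N r m : ℕ) : State k :=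
  if N ≤ 4 * k then startRound .straightforward N r m
  else if (N : ℝ) ≤ β * k * Real.log (k / δ) then startCMY N r m
  else startRound .custom N r m

open Classical in
/-- An item arrives at player `i` in a slack round with characteristics `A`. The `ℓ`-th
notification makes the coordinator collect all counters (`k` requests and `k` answers) and go on
with the remaining threshold as prescribed by `next`. -/
noncomputable def slackStep {k : ℕ} (A : Characteristics k) (next : ℕ → ℕ → ℕ → State k)
    (st : State k) (i : Fin k) : State k :=
  let n := Function.update st.cnt i (st.cnt i + 1)
  if A.notifies (A.slack st.thr i) (n i) then
    if st.notes + 1 = A.ell then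
      next (st.thr - ∑ j, n j) st.rounds (st.msgs + 1 + 2 * k)
    else { st with cnt := n, notes := st.notes + 1, msgs := st.msgs + 1 }
  else { st with cnt := n }

/-- An item arrives at player `i` while the straightforward algorithm is executed. -/
def straightStep {k : ℕ} (st : State k) (i : Fin k) : State k :=
  { st with
    mode := if st.notes + 1 = st.thr then .alarm else .straightforward
    cnt := Function.update st.cnt i (st.cnt i + 1)
    notes := st.notes + 1
    msgs := st.msgs + 1 }

/-- The effect of the arrival of one item at player `i`. -/
noncomputable def step {k : ℕ} (A : Characteristics k) (β δ : ℝ) (st : State k) (i : Fin k) :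
    State k :=
  match st.mode with
  | .alarm => st
  | .straightforward => straightStep st i
  | .cmy => slackStep (cmy k) startCMY st i
  | .custom => slackStep A (startFramework β δ) st i

/-- The state of the `ℓ`-Notifications-to-End algorithm with characteristics `A` and threshold `N`
after the arrival of the first `m` items, where `x j` is the player at which item `j` arrives. -/
noncomputable def run {k : ℕ} (A : Characteristics k) (β δ : ℝ) (N : ℕ) (x : ℕ → Fin k) :
    ℕ → State k
  | 0 => startFramework β δ N 0 0
  | m + 1 => step A β δ (run A β δ N x m) (x m)

/-- The execution of DynSlk-KwnDst, with the constant `β = 2 (√2 + 2/3)²`. -/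
noncomputable def dynSlkRun {k : ℕ} (N : ℕ) (δ : ℝ) (μ : Fin k → ℝ) (x : ℕ → Fin k) (m : ℕ) :
    State k :=
  run (dynSlk k δ μ) (2 * (√2 + 2 / 3) ^ 2) δ N x m

/-- The iterated logarithm `log log y`, read as `0` where it is negative or undefined. -/
noncomputable def loglog (y : ℝ) : ℝ := Real.posLog (Real.posLog y)

end DistributedTracking

/-!
The alarm itself is never at risk: the counters cannot add up to the threshold of a slack round
before its `k`-th notification, so every execution raises the alarm at the `N`-th item and only the
number of rounds has to be controlled; a round costs at most `5 k` messages.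

Let `L = log (k / δ)`. In a round with the known distribution and threshold `n`, if no player
notifies within the first `t - 2 √(k n L)` items, where `t` is the target, then only `O(√(k n L))`
items remain, so `log (n / (k L))` is roughly halved; this happens `O(log log (N / (k L)))` times
before `n` falls below `17 e k L`. From there on every round removes a constant fraction of `n`
whatever the arrivals, which leaves `O(log L)` rounds until `n < 4 k`.

By a Chernoff bound, a given player notifies too early with probability at most `δ / k`. The start
of a round at time `τ` depends only on the items before `τ`, and its failure only on later ones, so
each start is followed by a failure with probability at most `δ`. At most `R = O(log log N)` starts
matter on any path, hence the expected number of failures is at most `R δ`.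
-/

namespace DistributedTracking

open MeasureTheory ProbabilityTheory
open scoped Finset

section DependsOn

variable {Ω ι α : Type*} [MeasurableSpace α] [MeasurableSingletonClass α] [Finite α]
  {X : ι → Ω → α} {s t : Finset ι} {p q : (ι → α) → Prop}

lemma exists_measurableSet_preimage_of_dependsOn (hp : DependsOn p s) :
    ∃ A : Set (s → α), MeasurableSet A ∧
      {ω | p (X · ω)} = (fun ω (j : s) => X j ω) ⁻¹' A := by
  refine ⟨(fun ω (j : s) => X j ω) '' {ω | p (X · ω)}, (Set.toFinite _).measurableSet,
    (Set.subset_preimage_image _ _).antisymm ?_⟩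
  rintro ω ⟨ω', hω', heq⟩
  have hpω : p (X · ω') = p (X · ω) := hp fun j hj => congrFun heq ⟨j, hj⟩
  exact hpω.mp hω'

variable [MeasurableSpace Ω] {P : Measure Ω}

lemma measurableSet_of_dependsOn (hX : ∀ j, Measurable (X j)) (hp : DependsOn p s) :
    MeasurableSet {ω | p (X · ω)} := by
  obtain ⟨A, hA, h⟩ := exists_measurableSet_preimage_of_dependsOn (X := X) hp
  rw [h]
  exact (measurable_pi_lambda _ fun j : s => hX j) hA

lemma measureReal_inter_eq_mul_of_dependsOn (hX : ∀ j, Measurable (X j))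
    (hind : iIndepFun X P) (hst : Disjoint s t) (hp : DependsOn p s) (hq : DependsOn q t) :
    P.real ({ω | p (X · ω)} ∩ {ω | q (X · ω)}) =
      P.real {ω | p (X · ω)} * P.real {ω | q (X · ω)} := by
  obtain ⟨A, hA, hpA⟩ := exists_measurableSet_preimage_of_dependsOn (X := X) hp
  obtain ⟨B, hB, hqB⟩ := exists_measurableSet_preimage_of_dependsOn (X := X) hq
  rw [hpA, hqB, measureReal_def,
    (hind.indepFun_finset s t hst hX).measure_inter_preimage_eq_mul A B hA hB,
    ENNReal.toReal_mul, measureReal_def, measureReal_def]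

end DependsOn

section Probability

variable {Ω ι : Type*} [MeasurableSpace Ω] {P : Measure Ω}

lemma mgf_le_exp_of_mem_Icc_zero_one [IsProbabilityMeasure P] {Y : Ω → ℝ}
    (hm : AEMeasurable Y P) (hb : ∀ᵐ ω ∂P, Y ω ∈ Set.Icc 0 1) {l : ℝ} (hl : l ∈ Set.Icc 0 1) :
    mgf Y P l ≤ Real.exp ((l + l ^ 2) * P[Y]) := by
  have hint : Integrable Y P := .of_mem_Icc 0 1 hm hb
  have hexp : ∀ᵐ ω ∂P, Real.exp (l * Y ω) ≤ 1 + (l + l ^ 2) * Y ω := by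
    filter_upwards [hb] with ω hω
    have hlY : |l * Y ω| ≤ 1 := abs_le.2
      ⟨by linarith [mul_nonneg hl.1 hω.1], mul_le_one₀ hl.2 hω.1 hω.2⟩
    have h1 := (abs_le.1 (Real.abs_exp_sub_one_sub_id_le hlY)).2
    have h2 : (l * Y ω) ^ 2 ≤ l ^ 2 * Y ω := by
      rw [mul_pow]
      exact mul_le_mul_of_nonneg_left (pow_le_of_le_one hω.1 hω.2 two_ne_zero) (sq_nonneg l)
    linarith
  calc mgf Y P l ≤ ∫ ω, 1 + (l + l ^ 2) * Y ω ∂P :=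
        integral_mono_ae (integrable_exp_mul_of_mem_Icc hm hb)
          ((integrable_const 1).add (hint.const_mul _)) hexp
    _ = (l + l ^ 2) * P[Y] + 1 := by
        rw [integral_add (integrable_const 1) (hint.const_mul _), integral_const_mul]
        simp [add_comm]
    _ ≤ Real.exp ((l + l ^ 2) * P[Y]) := Real.add_one_le_exp _

theorem measureReal_le_sum_le_exp [IsProbabilityMeasure P] {Y : ι → Ω → ℝ}
    (hind : iIndepFun Y P) (hm : ∀ i, Measurable (Y i))
    (hb : ∀ i, ∀ᵐ ω ∂P, Y i ω ∈ Set.Icc 0 1) (s : Finset ι) (c : ℝ) {l : ℝ}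
    (hl : l ∈ Set.Icc 0 1) :
    P.real {ω | c ≤ ∑ i ∈ s, Y i ω} ≤ Real.exp ((l + l ^ 2) * ∑ i ∈ s, P[Y i] - l * c) := by
  have hmgf : mgf (∑ i ∈ s, Y i) P l ≤ Real.exp ((l + l ^ 2) * ∑ i ∈ s, P[Y i]) := by
    rw [hind.mgf_sum hm, Finset.mul_sum, Real.exp_sum]
    exact Finset.prod_le_prod (fun _ _ => mgf_nonneg) fun i _ =>
      mgf_le_exp_of_mem_Icc_zero_one (hm i).aemeasurable (hb i) hl
  have hint : Integrable (fun ω => Real.exp (l * (∑ i ∈ s, Y i) ω)) P :=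
    hind.integrable_exp_mul_sum hm fun i _ =>
      integrable_exp_mul_of_mem_Icc (hm i).aemeasurable (hb i)
  calc P.real {ω | c ≤ ∑ i ∈ s, Y i ω} = P.real {ω | c ≤ (∑ i ∈ s, Y i) ω} := by
        simp only [Finset.sum_apply]
    _ ≤ Real.exp (-l * c) * mgf (∑ i ∈ s, Y i) P l := measure_ge_le_exp_mul_mgf c hl.1 hint
    _ ≤ Real.exp (-l * c) * Real.exp ((l + l ^ 2) * ∑ i ∈ s, P[Y i]) := by gcongr
    _ = Real.exp ((l + l ^ 2) * ∑ i ∈ s, P[Y i] - l * c) := by rw [← Real.exp_add]; ring_nf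

open Classical in
lemma sum_measureReal_le_of_card_le [IsProbabilityMeasure P] {s : Finset ι} {S : ι → Set Ω}
    (hS : ∀ i ∈ s, MeasurableSet (S i)) {R : ℝ} (hR : ∀ ω, (#{i ∈ s | ω ∈ S i} : ℝ) ≤ R) :
    ∑ i ∈ s, P.real (S i) ≤ R := by
  have hint : ∀ i ∈ s, Integrable ((S i).indicator (1 : Ω → ℝ)) P := fun i hi =>
    (integrable_const (1 : ℝ)).indicator (hS i hi)
  calc ∑ i ∈ s, P.real (S i) = ∫ ω, ∑ i ∈ s, (S i).indicator (1 : Ω → ℝ) ω ∂P := by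
        rw [integral_finsetSum _ hint]
        exact Finset.sum_congr rfl fun i hi => (integral_indicator_one (hS i hi)).symm
    _ ≤ ∫ _, R ∂P := by
        refine integral_mono (integrable_finsetSum _ hint) (integrable_const R) fun ω => ?_
        simpa [Set.indicator_apply] using hR ω
    _ = R := by simp

open Classical in
theorem measureReal_biUnion_inter_le [IsProbabilityMeasure P] {s : Finset ι} {S B : ι → Set Ω}
    {ε R : ℝ} (hS : ∀ i ∈ s, MeasurableSet (S i)) (hε : 0 ≤ ε)
    (hSB : ∀ i ∈ s, P.real (S i ∩ B i) ≤ P.real (S i) * ε)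
    (hR : ∀ ω, (#{i ∈ s | ω ∈ S i} : ℝ) ≤ R) :
    P.real (⋃ i ∈ s, S i ∩ B i) ≤ R * ε :=
  calc P.real (⋃ i ∈ s, S i ∩ B i) ≤ ∑ i ∈ s, P.real (S i ∩ B i) :=
        measureReal_biUnion_finset_le _ _
    _ ≤ (∑ i ∈ s, P.real (S i)) * ε := by
        rw [Finset.sum_mul]
        exact Finset.sum_le_sum hSB
    _ ≤ R * ε := mul_le_mul_of_nonneg_right (sum_measureReal_le_of_card_le hS hR) hε

end Probability

section Tally

variable {α : Type*} [DecidableEq α] {x y : ℕ → α} {a b c : ℕ}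

/-- The number of those of the items `a, …, b - 1` of the sequence `x` that arrive at `i`. -/
def tally (x : ℕ → α) (a b : ℕ) (i : α) : ℕ := #{j ∈ Finset.Ico a b | x j = i}

lemma tally_self (x : ℕ → α) (a : ℕ) : tally x a a = fun _ => 0 := by
  simp [funext_iff, tally]

lemma tally_succ (x : ℕ → α) (hab : a ≤ b) :
    tally x a (b + 1) = Function.update (tally x a b) (x b) (tally x a b (x b) + 1) := by
  funext i
  rw [Function.update_apply, tally, ← Finset.insert_Ico_right_eq_Ico_add_one hab,
    Finset.filter_insert]
  split_ifs with h1 h2 h2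
  · rw [Finset.card_insert_of_notMem (by simp), tally, h1]
  · exact absurd h1.symm h2
  · exact absurd h2.symm h1
  · rfl

lemma tally_le_tally (x : ℕ → α) (hbc : b ≤ c) (i : α) : tally x a b i ≤ tally x a c i :=
  Finset.card_le_card (Finset.filter_subset_filter _ (Finset.Ico_subset_Ico_right hbc))

lemma sum_tally [Fintype α] (x : ℕ → α) (a b : ℕ) : ∑ i, tally x a b i = b - a := by
  rw [← Nat.card_Ico, Finset.card_eq_sum_card_fiberwise (f := x) (t := Finset.univ) (by simp)]
  rfl

lemma tally_congr (h : ∀ j ∈ Finset.Ico a b, x j = y j) : tally x a b = tally y a b := by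
  funext i
  exact congrArg Finset.card (Finset.filter_congr fun j hj => by rw [h j hj])

lemma cast_tally (x : ℕ → α) (a b : ℕ) (i : α) :
    (tally x a b i : ℝ) = ∑ j ∈ Finset.Ico a b, if x j = i then (1 : ℝ) else 0 := by
  simp [tally]

end Tally

section NotificationCounts

open Classical in
/-- The number of notifications that the coordinator has received in a round with threshold `n`
once the counters of the players have reached `c`. -/
noncomputable def Characteristics.noteCount {k : ℕ} (A : Characteristics k) (n : ℕ)
    (c : Fin k → ℕ) : ℕ :=
  ∑ i, Nat.count (fun m => A.notifies (A.slack n i) (m + 1)) (c i)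

namespace Characteristics

variable {k : ℕ} (A : Characteristics k) (n : ℕ)

lemma noteCount_zero : A.noteCount n (fun _ => 0) = 0 := by
  simp [noteCount]

open Classical in
lemma noteCount_update (c : Fin k → ℕ) (i : Fin k) :
    A.noteCount n (Function.update c i (c i + 1)) =
      A.noteCount n c + if A.notifies (A.slack n i) (c i + 1) then 1 else 0 := by
  have hrest : ∀ j ∈ Finset.univ.erase i,
      Nat.count (fun m => A.notifies (A.slack n j) (m + 1)) (Function.update c i (c i + 1) j) =
        Nat.count (fun m => A.notifies (A.slack n j) (m + 1)) (c j) := fun j hj => by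
    rw [Function.update_of_ne (Finset.ne_of_mem_erase hj)]
  simp only [noteCount, ← Finset.add_sum_erase _ _ (Finset.mem_univ i),
    Finset.sum_congr rfl hrest, Function.update_self, Nat.count_succ]
  ring

end Characteristics

open Classical in
lemma noteCount_cmy {k : ℕ} (n : ℕ) (c : Fin k → ℕ) :
    (cmy k).noteCount n c = ∑ i, c i / (n / (2 * k)) := by
  refine Finset.sum_congr rfl fun i _ => ?_
  rw [Nat.count_eq_card_filter_range, ← Nat.card_multiples]
  exact congrArg Finset.card (Finset.filter_congr fun _ _ => Iff.rfl)

open Classical in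
/-- The number of notifications sent by a player with counter `c` that notifies for every increase
by `s` once its counter has reached `a`. -/
noncomputable def notesAbove (a s c : ℕ) : ℕ :=
  Nat.count (fun m => ∃ j : ℕ, 1 ≤ j ∧ m + 1 = a + j * s) c

variable {a s c : ℕ}

open Classical in
lemma notesAbove_eq_div (hs : 1 ≤ s) : notesAbove a s c = (c - a) / s := by
  induction c with
  | zero => simp [notesAbove]
  | succ c ih =>
    rw [notesAbove, Nat.count_succ, ← notesAbove, ih]
    rcases Nat.lt_or_ge c a with hca | hac
    · have hno : ¬ ∃ j : ℕ, 1 ≤ j ∧ c + 1 = a + j * s := by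
        rintro ⟨j, hj, hc⟩
        have := Nat.mul_le_mul hj hs
        lia
      rw [if_neg hno, Nat.sub_eq_zero_of_le hca.le, Nat.sub_eq_zero_of_le hca, add_zero]
    · have hiff : (∃ j : ℕ, 1 ≤ j ∧ c + 1 = a + j * s) ↔ s ∣ c - a + 1 := by
        constructor
        · rintro ⟨j, -, hc⟩
          exact ⟨j, by lia⟩
        · rintro ⟨j, hj⟩
          exact ⟨j, Nat.pos_of_ne_zero (by rintro rfl; simp at hj), by lia⟩
      rw [Nat.succ_sub hac, Nat.succ_div]
      simp only [hiff]

open Classical in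
lemma notesAbove_eq_zero_iff (has : 1 ≤ a + s) : notesAbove a s c = 0 ↔ c < a + s := by
  rw [notesAbove, Nat.count_iff_forall_not]
  constructor
  · intro h
    by_contra! hc
    exact h (a + s - 1) (by lia) ⟨1, le_rfl, by lia⟩
  · rintro h m hm ⟨j, hj, hmj⟩
    have := Nat.mul_le_mul_right s hj
    lia

lemma lt_add_mul_notesAbove_add_one (hs : 1 ≤ s) : c < a + s * (notesAbove a s c + 1) := by
  have := Nat.lt_mul_div_succ (c - a) hs
  rw [notesAbove_eq_div hs]
  lia

lemma mul_notesAbove_le (s : ℕ) : s * notesAbove a s c ≤ c := by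
  rcases Nat.eq_zero_or_pos s with rfl | hs
  · simp
  · rw [notesAbove_eq_div hs]
    exact (Nat.mul_div_le _ _).trans (Nat.sub_le _ _)

end NotificationCounts

section Parameters

variable {k n d : ℕ} {δ : ℝ}

lemma two_le_sqrt_two_add : 2 ≤ √2 + 2 / 3 := by
  have : (4 / 3 : ℝ) ≤ √2 := Real.le_sqrt_of_sq_le (by norm_num)
  linarith

lemma sqrt_two_add_le : √2 + 2 / 3 ≤ 21 / 10 := by
  have : √2 ≤ (143 / 100 : ℝ) := Real.sqrt_le_iff.2 (by norm_num)
  linarith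

lemma log_div_pos (hk : 1 ≤ k) (hδ : 0 < δ) (hδ1 : δ < 1) : 0 < Real.log (k / δ) :=
  Real.log_pos ((one_lt_div hδ).2 (hδ1.trans_le (by exact_mod_cast hk)))

lemma half_le_log_div (hk : 2 ≤ k) (hδ : 0 < δ) (hδ1 : δ < 1) : 1 / 2 ≤ Real.log (k / δ) := by
  have hk' : (2 : ℝ) ≤ k := by exact_mod_cast hk
  have : Real.log 2 ≤ Real.log (k / δ) :=
    Real.log_le_log two_pos (hk'.trans (le_div_self (by positivity) hδ hδ1.le))
  linarith [Real.log_two_gt_d9]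

/-- The scale `√(k n log (k/δ))` of the deviations of the counters in a round with threshold `n`. -/
noncomputable def scale (k : ℕ) (δ : ℝ) (n : ℕ) : ℝ := √(k * n * Real.log (k / δ))

/-- The tolerance that DynSlk-KwnDst sends to the players in a round with threshold `n`. -/
noncomputable def tolerance (k : ℕ) (δ : ℝ) (n : ℕ) : ℕ := ⌊(n - target k δ n) / (2 * k)⌋₊

/-- The number of items within which, with high probability, no player sends a notification in a
round of DynSlk-KwnDst with threshold `n`. -/
noncomputable def quietLength (k : ℕ) (δ : ℝ) (n : ℕ) : ℕ := ⌊target k δ n - 2 * scale k δ n⌋₊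

lemma sub_target (k : ℕ) (δ : ℝ) (n : ℕ) : n - target k δ n = (√2 + 2 / 3) * scale k δ n := by
  simp [target, scale]

lemma two_mul_scale_le_sub_target (k : ℕ) (δ : ℝ) (n : ℕ) :
    2 * scale k δ n ≤ n - target k δ n := by
  rw [sub_target]
  exact mul_le_mul_of_nonneg_right two_le_sqrt_two_add (Real.sqrt_nonneg _)

/-- The conditions under which the framework runs a round of the plugged-in algorithm with
threshold `n`. -/
structure CustomThreshold (k : ℕ) (δ : ℝ) (n : ℕ) : Prop where
  one_le : 1 ≤ k
  δ_pos : 0 < δ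
  δ_lt_one : δ < 1
  four_mul_lt : 4 * k < n
  beta_mul_lt : 2 * (√2 + 2 / 3) ^ 2 * k * Real.log (k / δ) < n

namespace CustomThreshold

lemma one_le_cast (h : CustomThreshold k δ n) : (1 : ℝ) ≤ k := by exact_mod_cast h.one_le

lemma cast_pos (h : CustomThreshold k δ n) : (0 : ℝ) < n := by
  have := h.four_mul_lt
  exact_mod_cast (by lia)

lemma log_pos (h : CustomThreshold k δ n) : 0 < Real.log (k / δ) :=
  log_div_pos h.one_le h.δ_pos h.δ_lt_one

lemma scale_sq (h : CustomThreshold k δ n) : scale k δ n ^ 2 = k * n * Real.log (k / δ) :=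
  Real.sq_sqrt (mul_nonneg (by positivity) h.log_pos.le)

lemma scale_pos (h : CustomThreshold k δ n) : 0 < scale k δ n :=
  Real.sqrt_pos.2 (mul_pos (mul_pos (by linarith [h.one_le_cast]) h.cast_pos) h.log_pos)

/-- The factor `β = 2 (√2 + 2/3)²` makes the slack `n - t` at most `n / √2`. -/
lemma sub_target_le (h : CustomThreshold k δ n) : n - target k δ n ≤ 3 / 4 * n := by
  have hn := h.cast_pos
  have hsq : 2 * (n - target k δ n) ^ 2 ≤ (n : ℝ) ^ 2 := by
    calc 2 * (n - target k δ n) ^ 2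
        = 2 * (√2 + 2 / 3) ^ 2 * k * Real.log (k / δ) * (n : ℝ) := by
          rw [sub_target, mul_pow, h.scale_sq]; ring
      _ ≤ (n : ℝ) * n := mul_le_mul_of_nonneg_right h.beta_mul_lt.le hn.le
      _ = (n : ℝ) ^ 2 := (sq _).symm
  refine le_of_sq_le_sq ?_ (by positivity)
  nlinarith

lemma le_four_mul_target (h : CustomThreshold k δ n) : n ≤ 4 * target k δ n := by
  linarith [h.sub_target_le]

lemma target_pos (h : CustomThreshold k δ n) : 0 < target k δ n := by
  linarith [h.le_four_mul_target, h.cast_pos]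

lemma target_lt (h : CustomThreshold k δ n) : target k δ n < n := by
  linarith [two_mul_scale_le_sub_target k δ n, h.scale_pos]

lemma le_scale (h : CustomThreshold k δ n) (hk : 2 ≤ k) : (k : ℝ) ≤ scale k δ n := by
  refine Real.le_sqrt_of_sq_le ?_
  have hL := half_le_log_div hk h.δ_pos h.δ_lt_one
  have hn : (4 * k : ℝ) ≤ n := by exact_mod_cast h.four_mul_lt.le
  calc (k : ℝ) ^ 2 ≤ k * (4 * k) * (1 / 2) := by nlinarith [sq_nonneg (k : ℝ)]
    _ ≤ k * n * Real.log (k / δ) := by gcongr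

lemma scale_le_mul_tolerance (h : CustomThreshold k δ n) (hk : 2 ≤ k) :
    scale k δ n ≤ 2 * k * tolerance k δ n := by
  have hk0 : (0 : ℝ) < k := by linarith [h.one_le_cast]
  have hslack : scale k δ n / k ≤ (n - target k δ n) / (2 * k) := by
    rw [div_le_div_iff₀ hk0 (by positivity)]
    nlinarith [two_mul_scale_le_sub_target k δ n]
  have hone : 1 ≤ (n - target k δ n) / (2 * k) :=
    ((one_le_div hk0).2 (h.le_scale hk)).trans hslack
  have hfloor : scale k δ n / k / 2 ≤ tolerance k δ n :=
    (div_le_div_of_nonneg_right hslack zero_le_two).trans (Nat.div_two_lt_floor hone).le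
  rw [div_div, div_le_iff₀ (by positivity)] at hfloor
  linarith

lemma one_le_tolerance (h : CustomThreshold k δ n) (hk : 2 ≤ k) : 1 ≤ tolerance k δ n := by
  refine Nat.one_le_iff_ne_zero.2 fun h0 => ?_
  have := h.scale_le_mul_tolerance hk
  rw [h0, Nat.cast_zero, mul_zero] at this
  exact this.not_gt h.scale_pos

lemma mul_tolerance_le (h : CustomThreshold k δ n) :
    2 * k * (tolerance k δ n : ℝ) ≤ n - target k δ n := by
  have hk := h.one_le_cast
  have : (tolerance k δ n : ℝ) ≤ (n - target k δ n) / (2 * k) :=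
    Nat.floor_le (div_nonneg (sub_nonneg.2 h.target_lt.le) (by positivity))
  rwa [le_div_iff₀' (by positivity)] at this

lemma quietLength_mul_le (h : CustomThreshold k δ n) :
    quietLength k δ n * (1 + 2 * scale k δ n / n) ≤ target k δ n := by
  have hn := h.cast_pos
  have hσ := h.scale_pos
  rcases Nat.eq_zero_or_pos (quietLength k δ n) with h0 | h0
  · simpa [h0] using h.target_pos.le
  · have hq : (quietLength k δ n : ℝ) ≤ target k δ n - 2 * scale k δ n :=
      Nat.floor_le (Nat.pos_of_floor_pos h0).le
    have hqn : (quietLength k δ n : ℝ) / n ≤ 1 := by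
      rw [div_le_one hn]
      linarith [h.target_lt]
    calc quietLength k δ n * (1 + 2 * scale k δ n / n)
        = quietLength k δ n + 2 * scale k δ n * (quietLength k δ n / n) := by ring
      _ ≤ target k δ n := by nlinarith

lemma sub_sq_le_of_quietLength_lt (h : CustomThreshold k δ n) (hd : quietLength k δ n < d)
    (hdn : d ≤ n) : (n - d : ℝ) ^ 2 ≤ 17 * (k * Real.log (k / δ)) * n := by
  have hσ := h.scale_pos
  have hlt : target k δ n - 2 * scale k δ n < d := Nat.lt_of_floor_lt hd
  have hγ := mul_le_mul_of_nonneg_right sqrt_two_add_le hσ.le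
  have hle : (n - d : ℝ) ≤ 41 / 10 * scale k δ n := by linarith [sub_target k δ n]
  calc (n - d : ℝ) ^ 2 ≤ (41 / 10 * scale k δ n) ^ 2 :=
        pow_le_pow_left₀ (sub_nonneg.2 (by exact_mod_cast hdn)) hle 2
    _ ≤ 17 * scale k δ n ^ 2 := by nlinarith [sq_nonneg (scale k δ n)]
    _ = 17 * (k * Real.log (k / δ)) * n := by rw [h.scale_sq]; ring

end CustomThreshold

end Parameters

section SlackRounds

variable {k n : ℕ}

lemma cmy_sum_lt (hk : 1 ≤ k) (hn : 2 * k ≤ n) {c : Fin k → ℕ} (hc : (cmy k).noteCount n c < k) :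
    ∑ i, c i < n := by
  rw [noteCount_cmy] at hc
  set s := n / (2 * k)
  have hs1 : 0 < s := Nat.div_pos hn (by lia)
  calc ∑ i, c i ≤ ∑ i, (s * (c i / s) + s) := Finset.sum_le_sum fun i _ => by
        have := Nat.lt_mul_div_succ (c i) hs1
        lia
    _ = s * (∑ i, c i / s) + k * s := by simp [Finset.sum_add_distrib, Finset.mul_sum]
    _ < s * k + k * s := by gcongr
    _ = s * (2 * k) := by ring
    _ ≤ n := Nat.div_mul_le_self _ _

lemma le_four_mul_sum_of_cmy (hk : 1 ≤ k) (hn : 2 * k ≤ n) {c : Fin k → ℕ}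
    (hc : (cmy k).noteCount n c = k) : n ≤ 4 * ∑ i, c i := by
  rw [noteCount_cmy] at hc
  set s := n / (2 * k)
  have hs1 : 0 < s := Nat.div_pos hn (by lia)
  have hsum : s * k ≤ ∑ i, c i := by
    calc s * k = ∑ i, s * (c i / s) := by rw [← Finset.mul_sum, hc]
      _ ≤ ∑ i, c i := Finset.sum_le_sum fun i _ => Nat.mul_div_le _ _
  have hlt : n < 2 * k * (s + 1) := Nat.lt_mul_div_succ n (by lia)
  nlinarith

variable {δ : ℝ} {μ : Fin k → ℝ} {c : Fin k → ℕ}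

lemma noteCount_dynSlk (n : ℕ) (c : Fin k → ℕ) :
    (dynSlk k δ μ).noteCount n c =
      ∑ i, notesAbove ⌈μ i * target k δ n⌉₊ (tolerance k δ n) (c i) := rfl

lemma noteCount_dynSlk_eq_zero (hc : ∀ i, c i < ⌈μ i * target k δ n⌉₊ + tolerance k δ n) :
    (dynSlk k δ μ).noteCount n c = 0 := by
  rw [noteCount_dynSlk]
  exact Finset.sum_eq_zero fun i _ =>
    (notesAbove_eq_zero_iff (Nat.one_le_of_lt (hc i))).2 (hc i)

namespace CustomThreshold

lemma counter_lt (h : CustomThreshold k δ n) (hμ : ∑ i, μ i = 1)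
    (hc : (dynSlk k δ μ).noteCount n c < k) (i : Fin k) :
    c i < ⌈μ i * target k δ n⌉₊ + tolerance k δ n *
      (notesAbove ⌈μ i * target k δ n⌉₊ (tolerance k δ n) (c i) + 1) := by
  rcases Nat.lt_or_ge k 2 with hk | hk
  · obtain rfl : k = 1 := by have := h.one_le; lia
    rw [noteCount_dynSlk, Fin.sum_univ_one, Nat.lt_one_iff] at hc
    rw [Fin.sum_univ_one] at hμ
    have hb : 1 ≤ ⌈μ 0 * target 1 δ n⌉₊ := by
      rw [hμ, one_mul]
      exact Nat.one_le_ceil_iff.2 h.target_pos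
    rw [Subsingleton.elim i 0, hc, zero_add, mul_one]
    exact (notesAbove_eq_zero_iff (by lia)).1 hc
  · exact lt_add_mul_notesAbove_add_one (h.one_le_tolerance hk)

lemma dynSlk_sum_lt (h : CustomThreshold k δ n) (hμ0 : ∀ i, 0 ≤ μ i) (hμ : ∑ i, μ i = 1)
    (hc : (dynSlk k δ μ).noteCount n c < k) : ∑ i, c i < n := by
  have ht := h.target_pos
  set s := tolerance k δ n
  set ν : Fin k → ℕ := fun i => notesAbove ⌈μ i * target k δ n⌉₊ s (c i)
  have hcount : (∑ i, (ν i : ℝ)) + 1 ≤ k := by exact_mod_cast hc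
  have hcounter : ∀ i, (c i : ℝ) < μ i * target k δ n + s * (ν i + 1) := fun i => by
    have hceil := Nat.ceil_lt_add_one (mul_nonneg (hμ0 i) ht.le)
    have : (c i : ℝ) + 1 ≤ ⌈μ i * target k δ n⌉₊ + s * (ν i + 1) := by
      exact_mod_cast h.counter_lt hμ hc i
    linarith
  have hne : (Finset.univ : Finset (Fin k)).Nonempty := ⟨⟨0, h.one_le⟩, Finset.mem_univ _⟩
  have hsum : (∑ i, (c i : ℝ)) < n := by
    calc ∑ i, (c i : ℝ) < ∑ i, (μ i * target k δ n + s * (ν i + 1)) :=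
          Finset.sum_lt_sum_of_nonempty hne fun i _ => hcounter i
      _ = target k δ n + s * (∑ i, (ν i : ℝ) + k) := by
          simp [Finset.sum_add_distrib, ← Finset.sum_mul, ← Finset.mul_sum, hμ]
      _ ≤ target k δ n + s * (k + k) := by gcongr; linarith
      _ ≤ n := by linarith [h.mul_tolerance_le]
  exact_mod_cast hsum

lemma le_mul_sum_of_dynSlk (h : CustomThreshold k δ n) (hμ : ∑ i, μ i = 1)
    (hn : (n : ℝ) ≤ 49 * (k * Real.log (k / δ))) (hc : (dynSlk k δ μ).noteCount n c = k) :
    (n : ℝ) ≤ 14 * ∑ i, (c i : ℝ) := by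
  rw [noteCount_dynSlk] at hc
  have hn0 := h.cast_pos
  rcases Nat.lt_or_ge k 2 with hk | hk
  · obtain rfl : k = 1 := by have := h.one_le; lia
    rw [Fin.sum_univ_one] at hμ hc ⊢
    have hc0 : ⌈μ 0 * target 1 δ n⌉₊ ≤ c 0 := by
      by_contra! hlt
      have := (notesAbove_eq_zero_iff (by lia)).2 (Nat.lt_add_right (tolerance 1 δ n) hlt)
      lia
    have : target 1 δ n ≤ c 0 := by
      simpa [hμ] using (Nat.le_ceil _).trans (Nat.cast_le (α := ℝ).2 hc0)
    linarith [h.le_four_mul_target]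
  · set s := tolerance k δ n
    have hsum : (k * s : ℝ) ≤ ∑ i, (c i : ℝ) := by
      have : k * s ≤ ∑ i, c i := by
        calc k * s = ∑ i, s * notesAbove ⌈μ i * target k δ n⌉₊ s (c i) := by
              rw [← Finset.mul_sum, hc, mul_comm]
          _ ≤ ∑ i, c i := Finset.sum_le_sum fun i _ => mul_notesAbove_le s
      exact_mod_cast this
    have hσ : n ≤ 7 * scale k δ n := by
      refine le_of_sq_le_sq ?_ (by linarith [h.scale_pos])
      rw [mul_pow, h.scale_sq]
      nlinarith
    linarith [h.scale_le_mul_tolerance hk]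

end CustomThreshold

end SlackRounds

section Potential

variable {L q q' : ℝ}

lemma loglog_nonneg (y : ℝ) : 0 ≤ loglog y := Real.posLog_nonneg

lemma loglog_le_loglog (hq : 0 ≤ q) (h : q ≤ q') : loglog q ≤ loglog q' :=
  Real.posLog_le_posLog Real.posLog_nonneg (Real.posLog_le_posLog hq h)

lemma half_le_log_two : 1 / 2 ≤ Real.log 2 := by
  linarith [Real.log_two_gt_d9]

/-- The number of rounds that shrink `q`, the remaining threshold per player, by a factor `13/14`
until it drops below `1`; only those that start with `q ≤ 17 e L` count. -/
noncomputable def slowPotential (L q : ℝ) : ℝ :=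
  Real.posLog (min q (17 * Real.exp 1 * L)) / Real.log (14 / 13)

/-- The number of rounds that replace `q`, the remaining threshold per player, by at most
`√(17 L q)`, that is, halve `log (q / (17 L))`, until `q` drops below `17 e L`. -/
noncomputable def fastPotential (L q : ℝ) : ℝ :=
  Real.posLog (2 * Real.posLog (q / (17 * L))) / Real.log 2

/-- An upper bound for the number of rounds that are needed from a remaining threshold of `q` per
player on, where `L = log (k/δ)`. -/
noncomputable def potential (L q : ℝ) : ℝ := 1 + slowPotential L q + fastPotential L q

lemma slowPotential_nonneg (L q : ℝ) : 0 ≤ slowPotential L q :=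
  div_nonneg Real.posLog_nonneg (Real.log_nonneg (by norm_num))

lemma fastPotential_nonneg (L q : ℝ) : 0 ≤ fastPotential L q :=
  div_nonneg Real.posLog_nonneg (Real.log_nonneg one_le_two)

lemma one_le_potential (L q : ℝ) : 1 ≤ potential L q := by
  rw [potential]
  linarith [slowPotential_nonneg L q, fastPotential_nonneg L q]

lemma slowPotential_le_slowPotential (hL : 0 < L) (hq : 0 ≤ q) (h : q ≤ q') :
    slowPotential L q ≤ slowPotential L q' :=
  div_le_div_of_nonneg_right
    (Real.posLog_le_posLog (le_min hq (by positivity)) (min_le_min_right _ h))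
    (Real.log_nonneg (by norm_num))

lemma fastPotential_le_fastPotential (hL : 0 < L) (hq : 0 ≤ q) (h : q ≤ q') :
    fastPotential L q ≤ fastPotential L q' :=
  div_le_div_of_nonneg_right
    (Real.posLog_le_posLog (by have := Real.posLog_nonneg (x := q / (17 * L)); positivity)
      (mul_le_mul_of_nonneg_left (Real.posLog_le_posLog (by positivity) (by gcongr)) zero_le_two))
    (Real.log_nonneg one_le_two)

lemma slowPotential_add_one_le (hq : 14 / 13 ≤ q) (hqL : q ≤ 17 * Real.exp 1 * L) (hq' : 0 ≤ q')
    (h : q' ≤ 13 / 14 * q) : slowPotential L q' + 1 ≤ slowPotential L q := by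
  have hlog : 0 < Real.log (14 / 13) := Real.log_pos (by norm_num)
  have hmin : Real.posLog (min q' (17 * Real.exp 1 * L)) ≤ Real.log q - Real.log (14 / 13) := by
    calc Real.posLog (min q' (17 * Real.exp 1 * L)) ≤ Real.posLog (13 / 14 * q) :=
          Real.posLog_le_posLog (le_min hq' (by linarith)) ((min_le_left _ _).trans h)
      _ = Real.log (q / (14 / 13)) := by
          rw [Real.posLog_eq_log (by rw [abs_of_nonneg] <;> linarith)]
          ring_nf
      _ = Real.log q - Real.log (14 / 13) := Real.log_div (by linarith) (by norm_num)
  have hlog_q : Real.posLog (min q (17 * Real.exp 1 * L)) = Real.log q := by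
    rw [min_eq_left hqL, Real.posLog_eq_log (by rw [abs_of_nonneg] <;> linarith)]
  rw [slowPotential, slowPotential, hlog_q, div_add_one hlog.ne']
  exact div_le_div_of_nonneg_right (by linarith) hlog.le

lemma fastPotential_add_one_le (hL : 0 < L) (hq : 17 * Real.exp 1 * L < q)
    (h : q' ^ 2 ≤ 17 * L * q) : fastPotential L q' + 1 ≤ fastPotential L q := by
  have hlog : 0 < Real.log 2 := Real.log_pos one_lt_two
  set u := Real.posLog (q / (17 * L)) with hu
  have hu1 : 1 ≤ u := by
    rw [← Real.log_exp 1]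
    refine (Real.log_le_log (Real.exp_pos 1) ?_).trans (le_max_right 0 _)
    rw [le_div_iff₀ (by positivity)]
    linarith
  have hhalf : 2 * Real.posLog (q' / (17 * L)) ≤ u := by
    rw [← Nat.cast_two, ← Real.posLog_pow]
    refine Real.posLog_le_posLog (by positivity) ?_
    rw [div_pow, div_le_div_iff₀ (by positivity) (by positivity)]
    nlinarith [mul_le_mul_of_nonneg_right h (by positivity : 0 ≤ 17 * L)]
  have hle : Real.posLog (2 * Real.posLog (q' / (17 * L))) ≤ Real.log u := by
    rw [← Real.posLog_eq_log (by rwa [abs_of_nonneg (by linarith)])]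
    exact Real.posLog_le_posLog (mul_nonneg zero_le_two Real.posLog_nonneg) hhalf
  have hdouble : Real.posLog (2 * u) = Real.log 2 + Real.log u := by
    rw [Real.posLog_eq_log (by rw [abs_of_nonneg] <;> linarith),
      Real.log_mul two_ne_zero (by linarith)]
  rw [fastPotential, fastPotential, ← hu, hdouble, div_add_one hlog.ne']
  exact div_le_div_of_nonneg_right (by linarith) hlog.le

lemma slowPotential_le_slowPotential_of_le (hL : 0 < L) (hq : 17 * Real.exp 1 * L ≤ q)
    (hq' : 0 ≤ q') : slowPotential L q' ≤ slowPotential L q := by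
  rw [slowPotential, slowPotential, min_eq_right hq]
  exact div_le_div_of_nonneg_right
    (Real.posLog_le_posLog (le_min hq' (by positivity)) (min_le_right _ _))
    (Real.log_nonneg (by norm_num))

lemma one_le_fastPotential (hL : 0 < L) (hq : 17 * Real.exp 1 * L < q) :
    1 ≤ fastPotential L q := by
  have hq0 : 0 ≤ q := le_trans (by positivity) hq.le
  have hzero : (0 : ℝ) ^ 2 ≤ 17 * L * q := by rw [sq, zero_mul]; positivity
  linarith [fastPotential_add_one_le hL hq hzero, fastPotential_nonneg L 0]

lemma potential_add_one_le_of_le_mul (hL : 0 < L) (hq : 14 / 13 ≤ q)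
    (hqL : q ≤ 17 * Real.exp 1 * L) (hq' : 0 ≤ q') (h : q' ≤ 13 / 14 * q) :
    potential L q' + 1 ≤ potential L q := by
  have := slowPotential_add_one_le hq hqL hq' h
  have := fastPotential_le_fastPotential hL hq' (by linarith : q' ≤ q)
  rw [potential, potential]
  linarith

lemma potential_add_one_le_of_sq_le (hL : 0 < L) (hq : 17 * Real.exp 1 * L < q) (hq' : 0 ≤ q')
    (hle : q' ≤ q) (h : q' ^ 2 ≤ 17 * L * q) : potential L q' + 1 ≤ potential L q := by
  have := fastPotential_add_one_le hL hq h
  have := slowPotential_le_slowPotential hL hq' hle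
  rw [potential, potential]
  linarith

lemma fastPotential_le (hL : 0 < L) (hq : 0 ≤ q) :
    fastPotential L q ≤ 1 + 2 * loglog (q / L) := by
  have hlog : 0 < Real.log 2 := Real.log_pos one_lt_two
  have hmono : Real.posLog (q / (17 * L)) ≤ Real.posLog (q / L) :=
    Real.posLog_le_posLog (by positivity) (by gcongr; linarith)
  have hnum : Real.posLog (2 * Real.posLog (q / (17 * L))) ≤ Real.log 2 + loglog (q / L) := by
    calc Real.posLog (2 * Real.posLog (q / (17 * L)))
        ≤ Real.posLog (2 * Real.posLog (q / L)) :=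
          Real.posLog_le_posLog (mul_nonneg zero_le_two Real.posLog_nonneg) (by gcongr)
      _ ≤ Real.posLog 2 + loglog (q / L) := Real.posLog_mul
      _ = Real.log 2 + loglog (q / L) := by rw [Real.posLog_eq_log (by norm_num)]
  rw [fastPotential, div_le_iff₀ hlog]
  nlinarith [half_le_log_two, loglog_nonneg (q / L)]

lemma slowPotential_le (hL : 0 < L) (hq : 0 ≤ q) :
    slowPotential L q ≤ 14 * (4 + Real.posLog L) := by
  have hlog : 1 / 14 ≤ Real.log (14 / 13) :=
    (by norm_num : (1 / 14 : ℝ) = 1 - (14 / 13)⁻¹).trans_le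
      (Real.one_sub_inv_le_log_of_pos (by norm_num))
  have hexp : 17 * Real.exp 1 ≤ Real.exp 4 := by
    have h4 : Real.exp 4 = Real.exp 1 ^ 3 * Real.exp 1 := by
      rw [← pow_succ, ← Real.exp_nat_mul]
      norm_num
    rw [h4]
    gcongr
    calc (17 : ℝ) ≤ 2.7 ^ 3 := by norm_num
      _ ≤ Real.exp 1 ^ 3 := by gcongr; linarith [Real.exp_one_gt_d9]
  have hnum : Real.posLog (min q (17 * Real.exp 1 * L)) ≤ 4 + Real.posLog L := by
    calc Real.posLog (min q (17 * Real.exp 1 * L)) ≤ Real.posLog (Real.exp 4 * L) :=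
          Real.posLog_le_posLog (le_min hq (by positivity))
            ((min_le_right _ _).trans (by gcongr))
      _ ≤ Real.posLog (Real.exp 4) + Real.posLog L := Real.posLog_mul
      _ = 4 + Real.posLog L := by
          rw [Real.posLog_eq_log (by rw [Real.abs_exp, Real.one_le_exp_iff]; norm_num),
            Real.log_exp]
  rw [slowPotential, div_le_iff₀ (by linarith)]
  nlinarith [Real.posLog_nonneg (x := L)]

theorem potential_le (hL : 0 < L) (hq : 0 ≤ q) :
    potential L q ≤ 58 * (1 + loglog (q / L) + Real.posLog L) := by
  rw [potential]
  linarith [slowPotential_le hL hq, fastPotential_le hL hq, loglog_nonneg (q / L),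
    Real.posLog_nonneg (x := L)]

lemma half_le_loglog {N : ℕ} (hN : 8 ≤ N) : 1 / 2 ≤ loglog N := by
  have hN' : (8 : ℝ) ≤ N := by exact_mod_cast hN
  have hlog8 : Real.log 8 = 3 * Real.log 2 := by
    rw [show (8 : ℝ) = 2 ^ 3 by norm_num, Real.log_pow, Nat.cast_ofNat]
  have hlog : 2 ≤ Real.posLog N := by
    refine le_trans ?_ (le_max_right 0 _)
    linarith [Real.log_le_log (by norm_num) hN', Real.log_two_gt_d9]
  exact half_le_log_two.trans ((Real.log_le_log two_pos hlog).trans (le_max_right 0 _))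

lemma fastPotential_le_four_mul_loglog {k N : ℕ} {δ : ℝ} (hk : 2 ≤ k)
    (hN : 8 ≤ N) (hδ : 0 < δ) (hδ1 : δ < 1) :
    fastPotential (Real.log (k / δ)) (N / k) ≤ 4 * loglog N := by
  have hL := half_le_log_div hk hδ hδ1
  have hk' : (2 : ℝ) ≤ k := by exact_mod_cast hk
  have hratio : (N / k / Real.log (k / δ) : ℝ) ≤ N := by
    rw [div_div]
    exact div_le_self (Nat.cast_nonneg N) (by nlinarith)
  have hloglog : loglog (N / k / Real.log (k / δ)) ≤ loglog N :=
    loglog_le_loglog (by positivity) hratio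
  linarith [fastPotential_le (L := Real.log (k / δ)) (q := N / k) (by linarith) (by positivity),
    half_le_loglog hN]

theorem potential_log_div_le {k : ℕ} {δ : ℝ} (hk : 1 ≤ k) (hδ : 0 < δ) (hδ1 : δ < 1) (N : ℕ) :
    potential (Real.log (k / δ)) (N / k) ≤
      58 * (1 + loglog (N / (k * Real.log (k / δ))) + loglog (k / δ)) := by
  have hL := log_div_pos hk hδ hδ1
  have hkδ : loglog (k / δ) = Real.posLog (Real.log (k / δ)) :=
    congrArg Real.posLog (max_eq_right hL.le)
  rw [← div_div, hkδ]
  exact potential_le hL (by positivity)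

end Potential

section Execution

variable {k : ℕ} {A : Characteristics k} {β δ : ℝ} {x : ℕ → Fin k} {s : ℕ → State k}
  {next : ℕ → ℕ → ℕ → State k} {mode : Mode} {N n a r m : ℕ}

lemma startRound_zero (mode : Mode) (r m : ℕ) :
    (startRound mode 0 r m : State k) = ⟨.alarm, 0, fun _ => 0, 0, r, m⟩ := if_pos rfl

lemma startRound_of_ne_zero (hn : n ≠ 0) (mode : Mode) (r m : ℕ) :
    (startRound mode n r m : State k) = ⟨mode, n, fun _ => 0, 0, r + 1, m + k⟩ := if_neg hn

lemma slackStep_eq (A : Characteristics k) (next : ℕ → ℕ → ℕ → State k) {c c' : Fin k → ℕ}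
    {i : Fin k} (hc' : c' = Function.update c i (c i + 1)) (hc : A.noteCount n c < A.ell) :
    slackStep A next ⟨mode, n, c, A.noteCount n c, r, m + A.noteCount n c⟩ i =
      if A.noteCount n c' = A.ell then next (n - ∑ j, c' j) r (m + A.ell + 2 * k)
      else ⟨mode, n, c', A.noteCount n c', r, m + A.noteCount n c'⟩ := by
  subst hc'
  have hself : Function.update c i (c i + 1) i = c i + 1 := Function.update_self ..
  by_cases hnote : A.notifies (A.slack n i) (Function.update c i (c i + 1) i)
  · have hcount : A.noteCount n (Function.update c i (c i + 1)) = A.noteCount n c + 1 := by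
      rw [A.noteCount_update, if_pos (hself ▸ hnote)]
    simp only [slackStep, if_pos hnote, hcount]
    split_ifs with hell
    · rw [add_assoc m, hell]
    · rfl
  · have hcount : A.noteCount n (Function.update c i (c i + 1)) = A.noteCount n c := by
      rw [A.noteCount_update, if_neg (hself ▸ hnote), add_zero]
    simp only [slackStep, if_neg hnote, hcount, if_neg hc.ne]

lemma exists_noteCount_tally_eq_ell (hell : 0 < A.ell)
    (hsafe : ∀ c, A.noteCount n c < A.ell → ∑ i, c i < n) (x : ℕ → Fin k) (a : ℕ) :
    ∃ d ≤ n, 0 < d ∧ A.noteCount n (tally x a (a + d)) = A.ell ∧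
      ∀ e < d, A.noteCount n (tally x a (a + e)) < A.ell := by
  classical
  have hn : A.ell ≤ A.noteCount n (tally x a (a + n)) := by
    by_contra! hlt
    have := hsafe _ hlt
    rw [sum_tally] at this
    lia
  have hex : ∃ d, A.ell ≤ A.noteCount n (tally x a (a + d)) := ⟨n, hn⟩
  have hlt : ∀ e < Nat.find hex, A.noteCount n (tally x a (a + e)) < A.ell := fun e he =>
    not_le.1 (Nat.find_min hex he)
  have hpos : 0 < Nat.find hex := by
    rw [Nat.find_pos, add_zero, tally_self, A.noteCount_zero]
    exact hell.not_ge
  refine ⟨Nat.find hex, Nat.find_min' hex hn, hpos, le_antisymm ?_ (Nat.find_spec hex), hlt⟩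
  obtain ⟨e, he⟩ := Nat.exists_eq_add_of_le' hpos
  have hlast := hlt e (by lia)
  rw [he, ← add_assoc, tally_succ x (Nat.le_add_right a e), A.noteCount_update]
  split_ifs <;> lia

lemma slackRound_state (hs : ∀ τ, (s τ).mode = mode → s (τ + 1) = slackStep A next (s τ) (x τ))
    (hn : n ≠ 0) (ha : s a = startRound mode n r m) {d : ℕ}
    (hd : ∀ e ≤ d, A.noteCount n (tally x a (a + e)) < A.ell) :
    s (a + d) = ⟨mode, n, tally x a (a + d), A.noteCount n (tally x a (a + d)), r + 1,
      m + k + A.noteCount n (tally x a (a + d))⟩ := by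
  induction d with
  | zero =>
    rw [add_zero, ha, startRound_of_ne_zero hn, tally_self, A.noteCount_zero, add_zero]
  | succ d ih =>
    have hstate := ih fun e he => hd e (by lia)
    have hlast := hd (d + 1) le_rfl
    rw [← add_assoc] at hlast ⊢
    rw [hs _ (by rw [hstate]), hstate,
      slackStep_eq A next (tally_succ x (Nat.le_add_right a d)) (hd d (by lia)),
      if_neg hlast.ne]

theorem exists_slackRound_end
    (hs : ∀ τ, (s τ).mode = mode → s (τ + 1) = slackStep A next (s τ) (x τ)) (hell : 0 < A.ell)
    (hsafe : ∀ c, A.noteCount n c < A.ell → ∑ i, c i < n) (ha : s a = startRound mode n r m) :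
    ∃ d ≤ n, 0 < d ∧ A.noteCount n (tally x a (a + d)) = A.ell ∧
      (∀ e < d, (s (a + e)).mode = mode) ∧
      s (a + d) = next (n - d) (r + 1) (m + k + A.ell + 2 * k) := by
  have hn : n ≠ 0 := by
    have := hsafe (fun _ => 0) (by rwa [A.noteCount_zero])
    lia
  obtain ⟨d, hdn, hpos, hcount, hlt⟩ := exists_noteCount_tally_eq_ell hell hsafe x a
  have hstate : ∀ e, e < d → _ := fun e he =>
    slackRound_state hs hn ha (d := e) fun e' he' => hlt e' (by lia)
  refine ⟨d, hdn, hpos, hcount, fun e he => by rw [hstate e he], ?_⟩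
  obtain ⟨e, rfl⟩ := Nat.exists_eq_add_of_le' hpos
  have hlast := hstate e (by lia)
  rw [← add_assoc] at hcount ⊢
  rw [hs _ (by rw [hlast]), hlast,
    slackStep_eq A next (tally_succ x (Nat.le_add_right a e)) (hlt e (by lia)), if_pos hcount,
    sum_tally, add_assoc a, Nat.add_sub_cancel_left]

/-- `s` is the sequence of states of an execution in which item `j` arrives at player `x j`, from
an arbitrary initial state. -/
def IsExecution (A : Characteristics k) (β δ : ℝ) (x : ℕ → Fin k) (s : ℕ → State k) : Prop :=
  ∀ τ, s (τ + 1) = step A β δ (s τ) (x τ)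

namespace IsExecution

lemma succ_of_alarm (hs : IsExecution A β δ x s) {τ : ℕ} (h : (s τ).mode = .alarm) :
    s (τ + 1) = s τ := by
  rw [hs τ]
  simp only [step, h]

lemma succ_of_straightforward (hs : IsExecution A β δ x s) {τ : ℕ}
    (h : (s τ).mode = .straightforward) : s (τ + 1) = straightStep (s τ) (x τ) := by
  rw [hs τ]
  simp only [step, h]

lemma succ_of_cmy (hs : IsExecution A β δ x s) {τ : ℕ} (h : (s τ).mode = .cmy) :
    s (τ + 1) = slackStep (cmy k) startCMY (s τ) (x τ) := by
  rw [hs τ]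
  simp only [step, h]

lemma succ_of_custom (hs : IsExecution A β δ x s) {τ : ℕ} (h : (s τ).mode = .custom) :
    s (τ + 1) = slackStep A (startFramework β δ) (s τ) (x τ) := by
  rw [hs τ]
  simp only [step, h]

lemma eq_of_alarm (hs : IsExecution A β δ x s) (h : (s a).mode = .alarm) {τ : ℕ} (hτ : a ≤ τ) :
    s τ = s a := by
  induction τ, hτ using Nat.le_induction with
  | base => rfl
  | succ τ _ ih => rw [hs.succ_of_alarm (by rwa [ih]), ih]

lemma straightforward_state (hs : IsExecution A β δ x s) (hn : n ≠ 0)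
    (ha : s a = startRound .straightforward n r m) {d : ℕ} (hd : d ≤ n) :
    s (a + d) = ⟨if d = n then .alarm else .straightforward, n, tally x a (a + d), d, r + 1,
      m + k + d⟩ := by
  induction d with
  | zero => rw [add_zero, ha, startRound_of_ne_zero hn, if_neg hn.symm, tally_self, add_zero]
  | succ d ih =>
    have hstate := ih (by lia)
    rw [if_neg (by lia)] at hstate
    rw [← add_assoc, hs.succ_of_straightforward (by rw [hstate]), hstate,
      tally_succ x (Nat.le_add_right a d)]
    rfl

end IsExecution

/-- From time `a` on, the execution `s` raises the alarm exactly at time `N`, after at most `ρ`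
rounds and at most `5 k` messages per round. -/
structure CompletesWithin (N : ℕ) (ρ : ℝ) (s : ℕ → State k) (a : ℕ) : Prop where
  alarm_iff : ∀ τ ≥ a, (s τ).mode = .alarm ↔ N ≤ τ
  rounds_le : ((s N).rounds : ℝ) ≤ ρ
  msgs_le : (s N).msgs ≤ 5 * k * (s N).rounds

variable {ρ : ℝ}

lemma CompletesWithin.of_later {d : ℕ} (h : CompletesWithin N ρ s (a + d)) (hd : a + d ≤ N)
    (hmode : ∀ e < d, (s (a + e)).mode = mode) (hne : mode ≠ .alarm) :
    CompletesWithin N ρ s a := by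
  refine ⟨fun τ hτ => ?_, h.rounds_le, h.msgs_le⟩
  rcases Nat.lt_or_ge τ (a + d) with hlt | hge
  · obtain ⟨e, rfl⟩ := Nat.exists_eq_add_of_le hτ
    rw [hmode e (by lia)]
    exact iff_of_false hne (by lia)
  · exact h.alarm_iff τ hge

namespace IsExecution

lemma completesWithin_of_alarm (hs : IsExecution A β δ x s) (h : (s N).mode = .alarm)
    (hρ : (s N).rounds ≤ ρ) (hm : (s N).msgs ≤ 5 * k * (s N).rounds) :
    CompletesWithin N ρ s N :=
  ⟨fun τ hτ => iff_of_true (by rwa [hs.eq_of_alarm h hτ]) hτ, hρ, hm⟩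

lemma completesWithin_of_startRound_straightforward (hs : IsExecution A β δ x s)
    (ha : s a = startRound .straightforward n r m) (hN : a + n = N) (hn : n ≤ 4 * k)
    (hm : m ≤ 5 * k * r) (hρ : r + 1 ≤ ρ) : CompletesWithin N ρ s a := by
  rcases eq_or_ne n 0 with rfl | hn0
  · rw [startRound_zero] at ha
    subst hN
    exact hs.completesWithin_of_alarm (by rw [add_zero, ha]) (by rw [add_zero, ha]; linarith)
      (by rwa [add_zero, ha])
  · have hstate := fun d => hs.straightforward_state hn0 ha (d := d)
    have hend : s N = ⟨.alarm, n, tally x a (a + n), n, r + 1, m + k + n⟩ := by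
      rw [← hN, hstate n le_rfl, if_pos rfl]
    subst hN
    refine (hs.completesWithin_of_alarm (by rw [hend]) (by rw [hend]; exact_mod_cast hρ)
      (by rw [hend]; lia)).of_later le_rfl (mode := .straightforward) (fun e he => ?_) (by simp)
    rw [hstate e he.le, if_neg he.ne]

end IsExecution

end Execution

section Rounds

variable {k : ℕ} {A : Characteristics k} {β δ L ρ : ℝ} {μ : Fin k → ℝ} {x : ℕ → Fin k}
  {s : ℕ → State k} {N n a d r m : ℕ}

lemma slackRound_msgs_le (hell : A.ell = k) (hm : m ≤ 5 * k * r) :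
    m + k + A.ell + 2 * k ≤ 5 * k * (r + 1) := by
  rw [hell]
  lia

namespace IsExecution

theorem completesWithin_of_startCMY (hs : IsExecution A β δ x s) (hk : 1 ≤ k) (hL : 0 < L)
    (ha : s a = startCMY n r m) (hN : a + n = N) (hm : m ≤ 5 * k * r)
    (hq : (n / k : ℝ) ≤ 17 * Real.exp 1 * L) (hρ : r + potential L (n / k) ≤ ρ) :
    CompletesWithin N ρ s a := by
  induction n using Nat.strong_induction_on generalizing a r m with
  | h n ih =>
    rw [startCMY] at ha
    split_ifs at ha with hn
    · exact hs.completesWithin_of_startRound_straightforward ha hN hn.le hm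
        (by linarith [one_le_potential L (n / k)])
    · have hk0 : (0 : ℝ) < k := by exact_mod_cast hk
      obtain ⟨d, hdn, hpos, hcount, hmode, hend⟩ := exists_slackRound_end (s := s) (x := x)
        (fun _ => hs.succ_of_cmy) hk (fun _ => cmy_sum_lt hk (by lia)) ha
      have hdrop : (((n - d : ℕ) : ℝ) / k) ≤ 13 / 14 * (n / k) := by
        have hsum := le_four_mul_sum_of_cmy hk (by lia) hcount
        rw [sum_tally] at hsum
        have : (14 * (n - d : ℕ) : ℝ) ≤ 13 * n := by exact_mod_cast (by lia)
        rw [← mul_div_assoc]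
        gcongr
        linarith
      have hfour : (4 : ℝ) ≤ n / k := by
        rw [le_div_iff₀ hk0]
        exact_mod_cast not_lt.1 hn
      have hpot := potential_add_one_le_of_le_mul hL (by linarith) hq (by positivity) hdrop
      exact (ih (n - d) (by lia) hend (by lia) (slackRound_msgs_le rfl hm) (by linarith)
        (by push_cast at *; linarith)).of_later (by lia) hmode (by simp)

end IsExecution

/-- In a round of DynSlk-KwnDst with threshold `n` that starts at time `τ`, some player sends a
notification within the first `quietLength k δ n` items: the failure of a round. -/
def Overfull (δ : ℝ) (μ : Fin k → ℝ) (n : ℕ) (x : ℕ → Fin k) (τ : ℕ) : Prop :=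
  ∃ i, ⌈μ i * target k δ n⌉₊ + tolerance k δ n ≤ tally x τ (τ + quietLength k δ n) i

lemma quietLength_lt_of_not_overfull (hk : 1 ≤ k) (hover : ¬Overfull δ μ n x a)
    (hcount : (dynSlk k δ μ).noteCount n (tally x a (a + d)) = k) : quietLength k δ n < d := by
  by_contra! hd
  have hzero : (dynSlk k δ μ).noteCount n (tally x a (a + d)) = 0 :=
    noteCount_dynSlk_eq_zero fun i => (tally_le_tally x (by lia) i).trans_lt
      (not_le.1 fun hi => hover ⟨i, hi⟩)
  lia

lemma CustomThreshold.potential_add_one_le (h : CustomThreshold k δ n) (hμ : ∑ i, μ i = 1)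
    (hdn : d ≤ n) (hcount : (dynSlk k δ μ).noteCount n (tally x a (a + d)) = k)
    (hover : 17 * Real.exp 1 * Real.log (k / δ) < n / k → ¬Overfull δ μ n x a) :
    potential (Real.log (k / δ)) ((n - d : ℕ) / k) + 1 ≤
      potential (Real.log (k / δ)) (n / k) := by
  have hL := h.log_pos
  have hk0 : (0 : ℝ) < k := by linarith [h.one_le_cast]
  have hq' : (0 : ℝ) ≤ (n - d : ℕ) / k := by positivity
  rcases le_or_gt (n / k : ℝ) (17 * Real.exp 1 * Real.log (k / δ)) with hslow | hfast
  · refine potential_add_one_le_of_le_mul hL ?_ hslow hq' ?_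
    · rw [le_div_iff₀ hk0]
      have : (4 * k : ℝ) < n := by exact_mod_cast h.four_mul_lt
      linarith
    · have hn : (n : ℝ) ≤ 49 * (k * Real.log (k / δ)) := by
        rw [div_le_iff₀ hk0] at hslow
        nlinarith [Real.exp_one_lt_d9, mul_pos hL hk0]
      have hsum := h.le_mul_sum_of_dynSlk hμ hn hcount
      rw [← Nat.cast_sum, sum_tally, Nat.add_sub_cancel_left] at hsum
      rw [← mul_div_assoc, Nat.cast_sub hdn]
      gcongr
      linarith
  · refine potential_add_one_le_of_sq_le hL hfast hq' (by gcongr; lia) ?_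
    have hsq := h.sub_sq_le_of_quietLength_lt
      (quietLength_lt_of_not_overfull h.one_le (hover hfast) hcount) hdn
    rw [Nat.cast_sub hdn, div_pow, div_le_iff₀ (by positivity)]
    field_simp
    linarith

/-- In the execution of DynSlk-KwnDst with threshold `N` a round of the known-distribution
algorithm starts at time `τ`, and it is one of the first `R` rounds. -/
def StartsCustomRound (N : ℕ) (δ : ℝ) (μ : Fin k → ℝ) (R : ℝ) (x : ℕ → Fin k) (τ : ℕ) : Prop :=
  CustomThreshold k δ (N - τ) ∧
    ∃ r m : ℕ, (r + 1 : ℝ) ≤ R ∧ dynSlkRun N δ μ x τ = startRound .custom (N - τ) r m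

/-- None of the first `R` rounds of DynSlk-KwnDst with threshold `N` fails. -/
def NoFailure (N : ℕ) (δ : ℝ) (μ : Fin k → ℝ) (R : ℝ) (x : ℕ → Fin k) : Prop :=
  ∀ τ < N, StartsCustomRound N δ μ R x τ → ¬Overfull δ μ (N - τ) x τ

lemma isExecution_dynSlkRun (N : ℕ) (δ : ℝ) (μ : Fin k → ℝ) (x : ℕ → Fin k) :
    IsExecution (dynSlk k δ μ) (2 * (√2 + 2 / 3) ^ 2) δ x (dynSlkRun N δ μ x) := fun _ => rfl

lemma NoFailure.not_overfull
    (h : NoFailure N δ μ (fastPotential (Real.log (k / δ)) (N / k)) x)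
    (hn : CustomThreshold k δ n) (hN : a + n = N)
    (ha : dynSlkRun N δ μ x a = startRound .custom n r m)
    (hρ : r + potential (Real.log (k / δ)) (n / k) ≤ potential (Real.log (k / δ)) (N / k))
    (hfast : 17 * Real.exp 1 * Real.log (k / δ) < n / k) : ¬Overfull δ μ n x a := by
  have hn_eq : n = N - a := by lia
  have hround : (r + 1 : ℝ) ≤ fastPotential (Real.log (k / δ)) (N / k) := by
    have hslow : slowPotential (Real.log (k / δ)) (N / k) ≤ _ :=
      slowPotential_le_slowPotential_of_le hn.log_pos hfast.le (by positivity)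
    have := one_le_fastPotential hn.log_pos hfast
    rw [potential, potential] at hρ
    linarith
  have hpos := hn.four_mul_lt
  subst hn_eq
  exact h a (by lia) ⟨hn, r, m, hround, ha⟩

lemma NoFailure.completesWithin_of_startFramework (hδ : 0 < δ) (hδ1 : δ < 1)
    (hμ0 : ∀ i, 0 ≤ μ i) (hμ : ∑ i, μ i = 1) (hk : 1 ≤ k)
    (h : NoFailure N δ μ (fastPotential (Real.log (k / δ)) (N / k)) x)
    (ha : dynSlkRun N δ μ x a = startFramework (2 * (√2 + 2 / 3) ^ 2) δ n r m) (hN : a + n = N)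
    (hm : m ≤ 5 * k * r)
    (hρ : r + potential (Real.log (k / δ)) (n / k) ≤ potential (Real.log (k / δ)) (N / k)) :
    CompletesWithin N (potential (Real.log (k / δ)) (N / k)) (dynSlkRun N δ μ x) a := by
  have hs := isExecution_dynSlkRun N δ μ x
  have hk0 : (0 : ℝ) < k := by exact_mod_cast hk
  have hL : 0 < Real.log (k / δ) := log_div_pos hk hδ hδ1
  induction n using Nat.strong_induction_on generalizing a r m with
  | h n ih =>
    rw [startFramework] at ha
    split_ifs at ha with hn hβ
    · exact hs.completesWithin_of_startRound_straightforward ha hN hn hm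
        (by linarith [one_le_potential (Real.log (k / δ)) (n / k)])
    · refine hs.completesWithin_of_startCMY hk hL ha hN hm ?_ hρ
      have hβ_le : 2 * (√2 + 2 / 3) ^ 2 ≤ 17 * Real.exp 1 := by
        nlinarith [sqrt_two_add_le, two_le_sqrt_two_add, Real.exp_one_gt_d9]
      rw [div_le_iff₀ hk0]
      nlinarith [mul_le_mul_of_nonneg_right hβ_le (mul_pos hk0 hL).le]
    · have hthr : CustomThreshold k δ n := ⟨hk, hδ, hδ1, not_le.1 hn, not_le.1 hβ⟩
      obtain ⟨d, hdn, hpos, hcount, hmode, hend⟩ := exists_slackRound_end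
        (s := dynSlkRun N δ μ x) (x := x) (fun _ => hs.succ_of_custom) hk
        (fun _ => hthr.dynSlk_sum_lt hμ0 hμ) ha
      have hpot := hthr.potential_add_one_le hμ hdn hcount
        (h.not_overfull hthr hN ha hρ)
      exact (ih (n - d) (by lia) hend (by lia) (slackRound_msgs_le rfl hm)
        (by push_cast at *; linarith)).of_later (by lia) hmode (by simp)

theorem NoFailure.completesWithin (hδ : 0 < δ) (hδ1 : δ < 1)
    (hμ0 : ∀ i, 0 ≤ μ i) (hμ : ∑ i, μ i = 1) (hk : 1 ≤ k)
    (h : NoFailure N δ μ (fastPotential (Real.log (k / δ)) (N / k)) x) :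
    CompletesWithin N (potential (Real.log (k / δ)) (N / k)) (dynSlkRun N δ μ x) 0 :=
  h.completesWithin_of_startFramework hδ hδ1 hμ0 hμ hk (r := 0) (m := 0) rfl (zero_add N) le_rfl
    (by rw [Nat.cast_zero, zero_add])

end Rounds

section Starts

variable {k : ℕ} {A : Characteristics k} {β δ R : ℝ} {μ : Fin k → ℝ} {x : ℕ → Fin k}
  {s : ℕ → State k} {N a : ℕ}

lemma le_rounds_startRound (mode : Mode) (n r m : ℕ) :
    r ≤ (startRound mode n r m : State k).rounds := by
  rw [startRound]
  split_ifs
  exacts [le_rfl, Nat.le_succ r]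

lemma lt_rounds_startRound {mode : Mode} {n r m : ℕ}
    (h : (startRound mode n r m : State k).mode ≠ .alarm) :
    r < (startRound mode n r m : State k).rounds := by
  rcases eq_or_ne n 0 with rfl | hn
  · exact absurd rfl (startRound_zero (k := k) mode r m ▸ h)
  · exact (startRound_of_ne_zero (k := k) hn mode r m).symm ▸ Nat.lt_succ_self r

lemma exists_startRound_eq_startFramework (β δ : ℝ) (n r m : ℕ) :
    ∃ mode, (startFramework β δ n r m : State k) = startRound mode n r m := by
  rw [startFramework, startCMY]
  split_ifs <;> exact ⟨_, rfl⟩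

lemma slackStep_continues_or (A : Characteristics k) (next : ℕ → ℕ → ℕ → State k) (st : State k)
    (i : Fin k) :
    ((slackStep A next st i).cnt = Function.update st.cnt i (st.cnt i + 1) ∧
        (slackStep A next st i).rounds = st.rounds) ∨
      ∃ n m, slackStep A next st i = next n st.rounds m := by
  simp only [slackStep]
  split_ifs
  exacts [.inr ⟨_, _, rfl⟩, .inl ⟨rfl, rfl⟩, .inl ⟨rfl, rfl⟩]

lemma step_continues_or (A : Characteristics k) (β δ : ℝ) {st : State k} (h : st.mode ≠ .alarm)
    (i : Fin k) :
    ((step A β δ st i).cnt = Function.update st.cnt i (st.cnt i + 1) ∧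
        (step A β δ st i).rounds = st.rounds) ∨
      ∃ mode n m, step A β δ st i = startRound mode n st.rounds m := by
  cases hmode : st.mode with
  | alarm => exact absurd hmode h
  | straightforward =>
    simp only [step, hmode]
    exact .inl ⟨rfl, rfl⟩
  | cmy =>
    simp only [step, hmode]
    exact (slackStep_continues_or (cmy k) startCMY st i).imp_right fun ⟨n, m, h⟩ => ⟨_, n, m, h⟩
  | custom =>
    simp only [step, hmode]
    refine (slackStep_continues_or A (startFramework β δ) st i).imp_right fun ⟨n, m, h⟩ => ?_
    obtain ⟨mode, hstart⟩ := exists_startRound_eq_startFramework (k := k) β δ n st.rounds m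
    exact ⟨mode, n, m, h.trans hstart⟩

namespace IsExecution

lemma monotone_rounds (hs : IsExecution A β δ x s) : Monotone fun τ => (s τ).rounds := by
  refine monotone_nat_of_le_succ fun τ => ?_
  by_cases h : (s τ).mode = .alarm
  · rw [hs.succ_of_alarm h]
  · rw [hs τ]
    rcases step_continues_or A β δ h (x τ) with ⟨-, heq⟩ | ⟨mode, n, m, heq⟩
    · exact heq.ge
    · exact heq ▸ le_rounds_startRound mode n (s τ).rounds m

lemma rounds_lt_of_cnt_eq_zero (hs : IsExecution A β δ x s) {τ : ℕ} (haτ : a < τ)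
    (hmode : (s τ).mode ≠ .alarm) (hcnt : (s τ).cnt = fun _ => 0) :
    (s a).rounds < (s τ).rounds := by
  obtain ⟨e, rfl⟩ := Nat.exists_eq_add_one.2 (Nat.zero_lt_of_lt haτ)
  have he : (s e).mode ≠ .alarm := fun h => hmode (by rwa [hs.succ_of_alarm h])
  refine (hs.monotone_rounds (Nat.le_of_lt_succ haτ)).trans_lt ?_
  rw [hs e] at hmode hcnt ⊢
  rcases step_continues_or A β δ he (x e) with ⟨hupdate, -⟩ | ⟨mode, n, m, heq⟩
  · simpa using congrFun (hupdate.symm.trans hcnt) (x e)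
  · rw [heq] at hmode ⊢
    exact lt_rounds_startRound hmode

end IsExecution

lemma strictMonoOn_rounds_startsCustomRound :
    StrictMonoOn (fun τ => (dynSlkRun N δ μ x τ).rounds)
      {τ | StartsCustomRound N δ μ R x τ} := by
  rintro a - τ ⟨hthr, r, m, -, hτ⟩ haτ
  have hne : N - τ ≠ 0 := by have := hthr.four_mul_lt; lia
  rw [startRound_of_ne_zero hne] at hτ
  exact (isExecution_dynSlkRun N δ μ x).rounds_lt_of_cnt_eq_zero haτ (by simp [hτ]) (by simp [hτ])

open Classical in
lemma card_startsCustomRound_le (hR : 0 ≤ R) :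
    (#{τ ∈ Finset.range N | StartsCustomRound N δ μ R x τ} : ℝ) ≤ R := by
  have hmaps : ∀ τ ∈ ({τ ∈ Finset.range N | StartsCustomRound N δ μ R x τ} : Finset ℕ),
      (dynSlkRun N δ μ x τ).rounds ∈ Finset.Icc 1 ⌊R⌋₊ := fun τ hτ => by
    obtain ⟨hthr, r, m, hr, hstart⟩ := (Finset.mem_filter.1 hτ).2
    have hne : N - τ ≠ 0 := by have := hthr.four_mul_lt; lia
    rw [hstart, startRound_of_ne_zero hne]
    exact Finset.mem_Icc.2 ⟨Nat.le_add_left 1 r, Nat.le_floor (by exact_mod_cast hr)⟩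
  have hcard := Finset.card_le_card_of_injOn _ hmaps
    (strictMonoOn_rounds_startsCustomRound.injOn.mono fun τ hτ => (Finset.mem_filter.1 hτ).2)
  rw [Nat.card_Icc, Nat.add_sub_cancel] at hcard
  exact (Nat.cast_le.2 hcard).trans (Nat.floor_le hR)

lemma dependsOn_run (A : Characteristics k) (β δ : ℝ) (N τ : ℕ) :
    DependsOn (fun x => run A β δ N x τ) (Finset.range τ) := by
  induction τ with
  | zero => exact fun _ _ _ => rfl
  | succ τ ih =>
    intro x y h
    have hτ : run A β δ N x τ = run A β δ N y τ := ih fun j hj => h j (by simp at hj ⊢; lia)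
    simp only [run, hτ, h τ (by simp)]

lemma dependsOn_startsCustomRound (N : ℕ) (δ : ℝ) (μ : Fin k → ℝ) (R : ℝ) (τ : ℕ) :
    DependsOn (fun x => StartsCustomRound N δ μ R x τ) (Finset.range τ) := fun x y h => by
  have hrun : dynSlkRun N δ μ x τ = dynSlkRun N δ μ y τ := dependsOn_run _ _ _ _ _ h
  simp only [StartsCustomRound, hrun]

lemma dependsOn_overfull (δ : ℝ) (μ : Fin k → ℝ) (n τ : ℕ) :
    DependsOn (fun x => Overfull δ μ n x τ)
      (Finset.Ico τ (τ + quietLength k δ n)) := fun x y h => by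
  simp only [Overfull, tally_congr h]

end Starts

section FailureProbability

variable {Ω : Type*} [MeasurableSpace Ω] {P : Measure Ω} [IsProbabilityMeasure P]

lemma measureReal_le_tally_le_exp {α : Type*} [DecidableEq α] [MeasurableSpace α]
    [MeasurableSingletonClass α] {X : ℕ → Ω → α} (hX : ∀ j, Measurable (X j))
    (hind : iIndepFun X P) {i : α} {p : ℝ} (hdist : ∀ j, P.real {ω | X j ω = i} = p) (a b : ℕ)
    (c : ℝ) {l : ℝ} (hl : l ∈ Set.Icc 0 1) :
    P.real {ω | c ≤ tally (X · ω) a b i} ≤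
      Real.exp ((l + l ^ 2) * ((b - a : ℕ) * p) - l * c) := by
  set Y : ℕ → Ω → ℝ := fun j => {ω | X j ω = i}.indicator 1 with hY
  have hset : ∀ j, MeasurableSet {ω | X j ω = i} := fun j => hX j (measurableSet_singleton i)
  have hYind : iIndepFun Y P :=
    hind.comp (fun _ => ({i} : Set α).indicator 1)
      fun _ => measurable_one.indicator (measurableSet_singleton i)
  have hYb : ∀ j, ∀ᵐ ω ∂P, Y j ω ∈ Set.Icc 0 1 := fun j => .of_forall fun ω =>
    ⟨Set.indicator_nonneg (fun _ _ => zero_le_one) ω,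
      Set.indicator_le_self' (fun _ _ => zero_le_one) ω⟩
  have htally : {ω | c ≤ tally (X · ω) a b i} = {ω | c ≤ ∑ j ∈ Finset.Ico a b, Y j ω} := by
    simp only [cast_tally, hY, Set.indicator_apply, Set.mem_ofPred_eq, Pi.one_apply]
  have hmean : ∑ j ∈ Finset.Ico a b, P[Y j] = (b - a : ℕ) * p := by
    simp only [hY, integral_indicator_one (hset _), hdist, Finset.sum_const, Nat.card_Ico,
      nsmul_eq_mul]
  rw [htally, ← hmean]
  exact measureReal_le_sum_le_exp hYind (fun j => measurable_one.indicator (hset j)) hYb _ c hl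

variable {k N n : ℕ} {δ : ℝ} {μ : Fin k → ℝ} {X : ℕ → Ω → Fin k}

namespace CustomThreshold

lemma two_mul_scale_div_mem_Icc (h : CustomThreshold k δ n) :
    2 * scale k δ n / n ∈ Set.Icc 0 1 := by
  have hn := h.cast_pos
  have hσ := h.scale_pos
  refine ⟨by positivity, (div_le_one hn).2 ?_⟩
  linarith [two_mul_scale_le_sub_target k δ n, h.target_pos]

lemma log_le_two_mul_scale_div_mul_tolerance (h : CustomThreshold k δ n) (hk : 2 ≤ k) :
    Real.log (k / δ) ≤ 2 * scale k δ n / n * tolerance k δ n := by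
  have hn := h.cast_pos
  have hk0 : (0 : ℝ) < k := by linarith [h.one_le_cast]
  have hkn : (k * n : ℝ) * Real.log (k / δ) ≤ k * (2 * scale k δ n * tolerance k δ n) := by
    calc (k * n : ℝ) * Real.log (k / δ) = scale k δ n * scale k δ n := by rw [← sq, h.scale_sq]
      _ ≤ scale k δ n * (2 * k * tolerance k δ n) :=
          mul_le_mul_of_nonneg_left (h.scale_le_mul_tolerance hk) h.scale_pos.le
      _ = k * (2 * scale k δ n * tolerance k δ n) := by ring
  rw [div_mul_eq_mul_div, le_div_iff₀ hn]
  rw [mul_assoc] at hkn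
  linarith [le_of_mul_le_mul_left hkn hk0]

lemma measureReal_overfull_player_le (h : CustomThreshold k δ n) (hk : 2 ≤ k)
    (hX : ∀ j, Measurable (X j)) (hind : iIndepFun X P) {i : Fin k} (hμ0 : 0 ≤ μ i)
    (hdist : ∀ j, P.real {ω | X j ω = i} = μ i) (τ : ℕ) :
    P.real {ω | ⌈μ i * target k δ n⌉₊ + tolerance k δ n ≤
      tally (X · ω) τ (τ + quietLength k δ n) i} ≤ δ / k := by
  have hδ := h.δ_pos
  have hk0 : (0 : ℝ) < k := by linarith [h.one_le_cast]
  set l := 2 * scale k δ n / n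
  have hl : l ∈ Set.Icc 0 1 := h.two_mul_scale_div_mem_Icc
  set c : ℝ := μ i * target k δ n + tolerance k δ n with hc
  have hexponent : (l + l ^ 2) * ((quietLength k δ n : ℕ) * μ i) - l * c ≤
      -Real.log (k / δ) := by
    have hmean : (l * μ i) * (quietLength k δ n * (1 + l)) ≤ (l * μ i) * target k δ n :=
      mul_le_mul_of_nonneg_left h.quietLength_mul_le (mul_nonneg hl.1 hμ0)
    have hlog := h.log_le_two_mul_scale_div_mul_tolerance hk
    rw [hc]
    linarith
  calc P.real {ω | ⌈μ i * target k δ n⌉₊ + tolerance k δ n ≤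
        tally (X · ω) τ (τ + quietLength k δ n) i}
      ≤ P.real {ω | c ≤ tally (X · ω) τ (τ + quietLength k δ n) i} :=
        measureReal_mono fun ω hω => by
          have hω' : (⌈μ i * target k δ n⌉₊ + tolerance k δ n : ℝ) ≤
            tally (X · ω) τ (τ + quietLength k δ n) i := by exact_mod_cast Set.mem_ofPred_eq ▸ hω
          exact (add_le_add_left (Nat.le_ceil _) _).trans hω'
    _ ≤ Real.exp (-Real.log (k / δ)) :=
        (measureReal_le_tally_le_exp hX hind hdist _ _ c hl).trans
          (Real.exp_le_exp.2 (by rwa [Nat.add_sub_cancel_left]))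
    _ = δ / k := by rw [Real.exp_neg, Real.exp_log (div_pos hk0 hδ), inv_div]

/-- A single player has received `quietLength` items after `quietLength` arrivals, which is less
than its base `target`. -/
lemma two_le_of_overfull (h : CustomThreshold k δ n) (hμ : ∑ i, μ i = 1) {x : ℕ → Fin k} {τ : ℕ}
    (hover : Overfull δ μ n x τ) : 2 ≤ k := by
  by_contra! hk
  obtain rfl : k = 1 := by have := h.one_le; lia
  obtain ⟨i, hi⟩ := hover
  have htally := sum_tally x τ (τ + quietLength 1 δ n)
  rw [Fin.sum_univ_one] at hμ htally
  rw [Subsingleton.elim i 0, hμ, one_mul, htally, Nat.add_sub_cancel_left] at hi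
  have hle : target 1 δ n ≤ quietLength 1 δ n :=
    (Nat.le_ceil _).trans (by exact_mod_cast (Nat.le_add_right _ _).trans hi)
  have hl : 0 < 2 * scale 1 δ n / n := div_pos (mul_pos two_pos h.scale_pos) h.cast_pos
  nlinarith [h.quietLength_mul_le, h.target_pos]

theorem measureReal_overfull_le (h : CustomThreshold k δ n) (hX : ∀ j, Measurable (X j))
    (hind : iIndepFun X P) (hμ0 : ∀ i, 0 ≤ μ i) (hμ : ∑ i, μ i = 1)
    (hdist : ∀ j i, P.real {ω | X j ω = i} = μ i) (τ : ℕ) :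
    P.real {ω | Overfull δ μ n (X · ω) τ} ≤ δ := by
  rcases Nat.lt_or_ge k 2 with hk | hk
  · have hempty : {ω | Overfull δ μ n (X · ω) τ} = ∅ :=
      Set.eq_empty_of_forall_notMem fun _ hω => (h.two_le_of_overfull hμ hω).not_gt hk
    rw [hempty, measureReal_empty]
    exact h.δ_pos.le
  · have hunion : {ω | Overfull δ μ n (X · ω) τ} = ⋃ i, {ω | ⌈μ i * target k δ n⌉₊ +
        tolerance k δ n ≤ tally (X · ω) τ (τ + quietLength k δ n) i} := by
      simp only [Overfull, Set.ofPred_exists]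
    have hk0 : (k : ℝ) ≠ 0 := by linarith [h.one_le_cast]
    calc P.real {ω | Overfull δ μ n (X · ω) τ} ≤ ∑ i, P.real {ω | ⌈μ i * target k δ n⌉₊ +
          tolerance k δ n ≤ tally (X · ω) τ (τ + quietLength k δ n) i} :=
          hunion ▸ measureReal_iUnion_fintype_le _
      _ ≤ ∑ _i : Fin k, δ / k := Finset.sum_le_sum fun i _ =>
          h.measureReal_overfull_player_le hk hX hind (hμ0 i) (fun j => hdist j i) τ
      _ = δ := by
          rw [Finset.sum_const, Finset.card_univ, Fintype.card_fin, nsmul_eq_mul,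
            mul_div_cancel₀ _ hk0]

end CustomThreshold

lemma not_noFailure_iff {R : ℝ} {x : ℕ → Fin k} :
    ¬NoFailure N δ μ R x ↔
      ∃ τ ∈ Finset.range N, StartsCustomRound N δ μ R x τ ∧ Overfull δ μ (N - τ) x τ := by
  simp only [NoFailure, Finset.mem_range, not_forall, not_not, exists_prop]

theorem measureReal_not_noFailure_le (hδ : 0 ≤ δ) (hX : ∀ j, Measurable (X j))
    (hind : iIndepFun X P) (hμ0 : ∀ i, 0 ≤ μ i) (hμ : ∑ i, μ i = 1)
    (hdist : ∀ j i, P.real {ω | X j ω = i} = μ i) {R : ℝ} (hR : 0 ≤ R) :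
    P.real {ω | ¬NoFailure N δ μ R (X · ω)} ≤ R * δ := by
  set S : ℕ → Set Ω := fun τ => {ω | StartsCustomRound N δ μ R (X · ω) τ}
  set B : ℕ → Set Ω := fun τ => {ω | Overfull δ μ (N - τ) (X · ω) τ}
  have hSB : ∀ τ ∈ Finset.range N, P.real (S τ ∩ B τ) ≤ P.real (S τ) * δ := fun τ _ => by
    have hdisj : Disjoint (Finset.range τ)
        (Finset.Ico τ (τ + quietLength k δ (N - τ))) :=
      Finset.disjoint_left.2 fun j hj hj' =>
        (Finset.mem_range.1 hj).not_ge (Finset.mem_Ico.1 hj').1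
    have hindep : P.real (S τ ∩ B τ) = P.real (S τ) * P.real (B τ) :=
      measureReal_inter_eq_mul_of_dependsOn hX hind hdisj
        (dependsOn_startsCustomRound N δ μ R τ) (dependsOn_overfull δ μ (N - τ) τ)
    rw [hindep]
    rcases (S τ).eq_empty_or_nonempty with hS | ⟨ω, hω⟩
    · rw [hS, measureReal_empty, zero_mul, zero_mul]
    · exact mul_le_mul_of_nonneg_left (hω.1.measureReal_overfull_le hX hind hμ0 hμ hdist τ)
        measureReal_nonneg
  have hunion : {ω | ¬NoFailure N δ μ R (X · ω)} = ⋃ τ ∈ Finset.range N, S τ ∩ B τ := by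
    ext ω
    simp only [Set.mem_iUnion, exists_prop]
    exact not_noFailure_iff
  rw [hunion]
  exact measureReal_biUnion_inter_le
    (fun τ _ => measurableSet_of_dependsOn hX (dependsOn_startsCustomRound N δ μ R τ)) hδ hSB
    fun ω => card_startsCustomRound_le hR

theorem measureReal_not_noFailure_le_loglog (hδ : 0 < δ) (hδ1 : δ < 1)
    (hX : ∀ j, Measurable (X j)) (hind : iIndepFun X P) (hμ0 : ∀ i, 0 ≤ μ i)
    (hμ : ∑ i, μ i = 1) (hdist : ∀ j i, P.real {ω | X j ω = i} = μ i) :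
    P.real {ω | ¬NoFailure N δ μ (fastPotential (Real.log (k / δ)) (N / k)) (X · ω)} ≤
      4 * δ * loglog N := by
  set R := fastPotential (Real.log (k / δ)) (N / k)
  rcases {ω | ¬NoFailure N δ μ R (X · ω)}.eq_empty_or_nonempty with hempty | ⟨ω, hω⟩
  · rw [hempty, measureReal_empty]
    exact mul_nonneg (by positivity) (loglog_nonneg _)
  · obtain ⟨τ, -, hstart, hover⟩ := not_noFailure_iff.1 hω
    have hk : 2 ≤ k := hstart.1.two_le_of_overfull hμ hover
    have hN : 8 ≤ N := by have := hstart.1.four_mul_lt; lia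
    calc P.real {ω | ¬NoFailure N δ μ R (X · ω)} ≤ R * δ :=
          measureReal_not_noFailure_le hδ.le hX hind hμ0 hμ hdist (fastPotential_nonneg _ _)
      _ ≤ 4 * loglog N * δ :=
          mul_le_mul_of_nonneg_right (fastPotential_le_four_mul_loglog hk hN hδ hδ1) hδ.le
      _ = 4 * δ * loglog N := by ring

theorem one_sub_le_measureReal_completesWithin (hδ : 0 < δ) (hδ1 : δ < 1)
    (hX : ∀ j, Measurable (X j)) (hind : iIndepFun X P) (hμ0 : ∀ i, 0 ≤ μ i)
    (hμ : ∑ i, μ i = 1) (hk : 1 ≤ k) (hdist : ∀ j i, P.real {ω | X j ω = i} = μ i) :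
    1 - 4 * δ * loglog N ≤ P.real {ω |
      CompletesWithin N (potential (Real.log (k / δ)) (N / k)) (dynSlkRun N δ μ (X · ω)) 0} := by
  have hcover : {ω | ¬NoFailure N δ μ (fastPotential (Real.log (k / δ)) (N / k)) (X · ω)} ∪
      {ω | CompletesWithin N (potential (Real.log (k / δ)) (N / k)) (dynSlkRun N δ μ (X · ω)) 0} =
      Set.univ :=
    Set.eq_univ_of_forall fun _ => not_or_of_imp fun h => h.completesWithin hδ hδ1 hμ0 hμ hk
  have hsum := measureReal_union_le (μ := P)
    {ω | ¬NoFailure N δ μ (fastPotential (Real.log (k / δ)) (N / k)) (X · ω)}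
    {ω | CompletesWithin N (potential (Real.log (k / δ)) (N / k)) (dynSlkRun N δ μ (X · ω)) 0}
  rw [hcover, probReal_univ] at hsum
  linarith [measureReal_not_noFailure_le_loglog (N := N) hδ hδ1 hX hind hμ0 hμ hdist]

end FailureProbability

end DistributedTracking

open MeasureTheory ProbabilityTheory DistributedTracking in
theorem mainTheorem3 :
    ∃ C : ℝ, 0 < C ∧
      ∀ (k N : ℕ) (μ : Fin k → ℝ) (δ : ℝ),
        (∀ i, 0 ≤ μ i) → ∑ i, μ i = 1 → 0 < δ → δ < 1 →
        ∀ (Ω : Type*) [MeasurableSpace Ω] (P : Measure Ω) [IsProbabilityMeasure P]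
          (X : ℕ → Ω → Fin k),
          (∀ j, Measurable (X j)) → iIndepFun X P →
          (∀ j i, P.real {ω | X j ω = i} = μ i) →
          1 - C * δ * loglog N ≤
            P.real {ω |
              -- the alarm is raised exactly at the arrival of the `N`-th item
              (∀ m, (dynSlkRun N δ μ (X · ω) m).mode = Mode.alarm ↔ N ≤ m) ∧
              ((dynSlkRun N δ μ (X · ω) N).rounds : ℝ) ≤
                C * (1 + loglog (N / (k * Real.log (k / δ))) + loglog (k / δ)) ∧
              ((dynSlkRun N δ μ (X · ω) N).msgs : ℝ) ≤
                C * (k * (1 + loglog (N / (k * Real.log (k / δ))) + loglog (k / δ)))} := by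
  refine ⟨290, by norm_num, fun k N μ δ hμ0 hμ hδ hδ1 Ω _ P _ X hX hind hdist => ?_⟩
  have hk : 1 ≤ k := Nat.one_le_iff_ne_zero.2 fun hk => by subst hk; simp at hμ
  calc 1 - 290 * δ * loglog N ≤ 1 - 4 * δ * loglog N := by
        linarith [mul_nonneg hδ.le (loglog_nonneg N)]
    _ ≤ _ := one_sub_le_measureReal_completesWithin hδ hδ1 hX hind hμ0 hμ hk hdist
    _ ≤ _ := measureReal_mono fun ω hω => by
      have hrounds := hω.rounds_le.trans (potential_log_div_le hk hδ hδ1 N)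
      have hmsgs : ((dynSlkRun N δ μ (X · ω) N).msgs : ℝ) ≤
          5 * k * (dynSlkRun N δ μ (X · ω) N).rounds := by exact_mod_cast hω.msgs_le
      refine ⟨fun m => hω.alarm_iff m m.zero_le, ?_, ?_⟩
      · linarith [(dynSlkRun N δ μ (X · ω) N).rounds.cast_nonneg (α := ℝ)]
      · linarith [mul_le_mul_of_nonneg_left hrounds (by positivity : 0 ≤ 5 * (k : ℝ))]
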